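/- **Theorem (Linkedness of the cube).** Let $d \ge 0$ be an integer with $d \neq 3$, and let $P$ be a $d$-cube, that is, a convex polytope in some $\mathbb{R}^n$ whose face lattice is isomorphic to the face lattice of the standard cube $[0,1]^d$. Then the graph of $P$, formed by the vertices and edges of $P$, is $\lfloor (d+1)/2 \rfloor$-linked. Here a graph $G$ is *$k$-linked* if it has at least $2k$ vertices and, for every set of $2k$ distinct vertices of $G$ and every partition of this set into unordered pairs $\{s_1,t_1\},\ldots,\{s_k,t_k\}$, there are pairwise vertex-disjoint paths $L_1,\ldots,L_k$ in $G$ such that $L_i$ joins $s_i$ and $t_i$ for each $i$. -/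

import Mathlib

/-- A graph `G` is `k`-linked if it has at least `2k` vertices and, for every choice of `2k`
distinct vertices organised (and labelled) in `k` pairs `{s i, t i}`, there are pairwise
vertex-disjoint paths in `G`, the `i`-th one joining `s i` and `t i`. -/
def SimpleGraph.IsKLinked {V : Type*} (G : SimpleGraph V) (k : ℕ) : Prop :=
  ((2 * k : ℕ) : ℕ∞) ≤ ENat.card V ∧
    ∀ s t : Fin k → V, Function.Injective (Sum.elim s t) →
      ∃ L : (i : Fin k) → G.Path (s i) (t i),
        ∀ i j : Fin k, i ≠ j → (L i).1.support.Disjoint (L j).1.support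

namespace Polytope

/-- A polytope in `ℝⁿ`: the convex hull of a finite set of points. -/
def IsPolytope {n : ℕ} (P : Set (Fin n → ℝ)) : Prop :=
  ∃ S : Set (Fin n → ℝ), S.Finite ∧ P = convexHull ℝ S

/-- The face lattice of `P`, ordered by inclusion. A face is the empty set or the set of points of
`P` at which some linear functional attains its maximum over `P` (the zero functional gives `P`
itself). -/
abbrev FaceLattice {n : ℕ} (P : Set (Fin n → ℝ)) : Type :=
  {F : Set (Fin n → ℝ) // IsExposed ℝ P F}

/-- Two polytopes are combinatorially equivalent if their face lattices are isomorphic. -/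
def CombinatoriallyEquivalent {m n : ℕ} (P : Set (Fin m → ℝ)) (Q : Set (Fin n → ℝ)) : Prop :=
  Nonempty (FaceLattice P ≃o FaceLattice Q)

/-- A `d`-cube: a polytope combinatorially equivalent to the standard cube `[0,1]ᵈ`. -/
def IsCube {n : ℕ} (d : ℕ) (P : Set (Fin n → ℝ)) : Prop :=
  IsPolytope P ∧ CombinatoriallyEquivalent P (Set.Icc (0 : Fin d → ℝ) 1)

/-- The vertices of `P`: the points `v` such that `{v}` is a face. -/
abbrev Vertex {n : ℕ} (P : Set (Fin n → ℝ)) : Type :=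
  {v : Fin n → ℝ // IsExposed ℝ P {v}}

/-- The graph of a polytope `P`: distinct vertices `u`, `v` are adjacent if and only if the segment
between them is a face (an edge) of `P`. -/
def graph {n : ℕ} (P : Set (Fin n → ℝ)) : SimpleGraph (Vertex P) where
  Adj u v := u ≠ v ∧ IsExposed ℝ P (segment ℝ u.1 v.1)
  symm := ⟨fun u v h => ⟨h.1.symm, by rw [segment_symm]; exact h.2⟩⟩
  loopless := ⟨fun _ h => h.1 rfl⟩

end Polytope

/-! The vertices of the cube are the Boolean vectors, and an edge toggles one coordinate. The proof
is an induction on dimension alternating between two properties of faces: a face of dimension `2k +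
1` links any `k + 1` pairs (`Linked`), and a face of dimension `2k` links any `k` pairs while
avoiding one prescribed further vertex (`StrongLinked`), for `k ≥ 2`.

From odd to even (`strongLinked_of_linked_facets`): `2k` terminals are separated by `2k - 1`
coordinates, so some direction carries no edge between terminals. Project all terminals along it to
the facet missing the forbidden vertex, and link them there.

From even to odd (`linked_of_strongLinked_facets`): some direction carries at most one edge between
the `2k + 2` terminals. One pair is linked through one facet, all others in the opposite facet,
avoiding the remaining end of the first pair (`link_of_split`). The first pair is joined because a
`d`-face stays connected after deleting `d - 1` vertices (`joined_face_diff`), or `d` vertices when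
the two ends are not isolated and `d ≥ 3` (`joined_face_diff_of_nonisolated`).

The induction starts at dimension 4 (`linkTwo_four`), by case analysis; the 3-cube fails to be
2-linked, so it cannot start lower. In dimensions below 3 only connectivity is needed.

For arbitrary polytopes, vertices are the atoms of the face lattice and edges are the faces above
exactly two atoms, so the lattice determines the graph
(`CombinatoriallyEquivalent.nonempty_graph_iso`). -/

namespace CubeGraph

/-! ### The cube graph: toggles, walks inside a set, faces -/

variable {ι : Type*} [DecidableEq ι]

/-- The vertex of the cube obtained from `v` by changing its `i`-th coordinate. -/
def toggle (i : ι) (v : ι → Bool) : ι → Bool := Function.update v i (!v i)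

@[simp] lemma toggle_same (i : ι) (v : ι → Bool) : toggle i v i = !v i := by simp [toggle]

lemma toggle_of_ne {i j : ι} (h : j ≠ i) (v : ι → Bool) : toggle i v j = v j := by
  simp [toggle, h]

@[simp] lemma toggle_toggle (i : ι) (v : ι → Bool) : toggle i (toggle i v) = v := by
  funext j
  by_cases h : j = i
  · subst h; simp
  · simp [toggle_of_ne h]

lemma toggle_ne_self (i : ι) (v : ι → Bool) : toggle i v ≠ v := by
  intro h
  have := congrFun h i
  simp at this

lemma toggle_injective (i : ι) : Function.Injective (toggle i) := fun u v h => by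
  rw [← toggle_toggle i u, h, toggle_toggle]

lemma eq_toggle_comm {i : ι} {u v : ι → Bool} (h : u = toggle i v) : v = toggle i u := by
  rw [h, toggle_toggle]

lemma toggle_dir_injective {i j : ι} {v : ι → Bool} (h : toggle i v = toggle j v) : i = j := by
  by_contra hij
  have := congrFun h i
  rw [toggle_same, toggle_of_ne hij] at this
  simp at this

lemma toggle_toggle_ne_toggle {l j : ι} (h : l ≠ j) (m : ι) (u : ι → Bool) :
    toggle l (toggle j u) ≠ toggle m u := by
  intro e
  have hl := congrFun e l
  have hj := congrFun e j
  rw [toggle_same, toggle_of_ne h] at hl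
  rw [toggle_of_ne h.symm, toggle_same] at hj
  have h1 : l = m := by
    by_contra hm
    rw [toggle_of_ne hm] at hl
    simp at hl
  have h2 : j = m := by
    by_contra hm
    rw [toggle_of_ne hm] at hj
    simp at hj
  exact h (h1.trans h2.symm)

/-- `u` and `v` are joined by a walk of the cube graph inside `A`. -/
def Joined (A : Set (ι → Bool)) (u v : ι → Bool) : Prop :=
  u ∈ A ∧ Relation.ReflTransGen (fun a b => b ∈ A ∧ ∃ i, b = toggle i a) u v

namespace Joined

variable {A B : Set (ι → Bool)} {u v w : ι → Bool}

lemma refl (h : u ∈ A) : Joined A u u := ⟨h, .refl⟩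

lemma trans (h : Joined A u v) (h' : Joined A v w) : Joined A u w := ⟨h.1, h.2.trans h'.2⟩

lemma left_mem (h : Joined A u v) : u ∈ A := h.1

lemma right_mem (h : Joined A u v) : v ∈ A := by
  rcases Relation.ReflTransGen.cases_tail h.2 with h' | ⟨_, _, h', _⟩
  · rw [h']; exact h.1
  · exact h'

lemma step (i : ι) (h : u ∈ A) (h' : toggle i u ∈ A) : Joined A u (toggle i u) :=
  ⟨h, .single ⟨h', i, rfl⟩⟩

lemma symm (h : Joined A u v) : Joined A v u := by
  obtain ⟨hu, h⟩ := h
  induction h with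
  | refl => exact refl hu
  | @tail b c hb hc ih =>
    obtain ⟨hcA, i, rfl⟩ := hc
    have := step (A := A) i hcA (by rw [toggle_toggle]; exact ih.left_mem)
    rw [toggle_toggle] at this
    exact this.trans ih

lemma mono (hAB : A ⊆ B) (h : Joined A u v) : Joined B u v :=
  ⟨hAB h.1, Relation.ReflTransGen.mono (fun _ _ h => ⟨hAB h.1, h.2⟩) _ _ h.2⟩

end Joined

/-- The face of the cube through `c` spanned by the directions in `I`. -/
def face (I : Finset ι) (c : ι → Bool) : Set (ι → Bool) := {v | ∀ j ∉ I, v j = c j}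

lemma mem_facet {I : Finset ι} {c v : ι → Bool} {i : ι} (hi : i ∈ I) {b : Bool} :
    v ∈ face (I.erase i) (Function.update c i b) ↔ v ∈ face I c ∧ v i = b := by
  constructor
  · intro h
    refine ⟨fun j hj => ?_, ?_⟩
    · have hji : j ≠ i := fun e => hj (e ▸ hi)
      have := h j (fun h' => hj (Finset.mem_of_mem_erase h'))
      rwa [Function.update_of_ne hji] at this
    · simpa using h i (by simp)
  · rintro ⟨h, hb⟩ j hj
    by_cases hji : j = i
    · subst hji; simpa using hb
    · rw [Function.update_of_ne hji]
      exact h j (fun h' => hj (Finset.mem_erase.2 ⟨hji, h'⟩))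

lemma facet_subset {I : Finset ι} {c : ι → Bool} {i : ι} (hi : i ∈ I) (b : Bool) :
    face (I.erase i) (Function.update c i b) ⊆ face I c := fun _ h => ((mem_facet hi).1 h).1

lemma toggle_mem_face {I : Finset ι} {c v : ι → Bool} {i : ι} (hi : i ∈ I) (hv : v ∈ face I c) :
    toggle i v ∈ face I c := fun j hj => by
  have hji : j ≠ i := fun e => hj (e ▸ hi)
  rw [toggle_of_ne hji, hv j hj]

/-! ### Connectivity of faces after deleting vertices -/

section Connectivity

/-- If fewer vertices than the dimension are removed from a face, then every remaining vertex is
still joined to the opposite side in a given direction. -/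
lemma exists_joined_opposite {J : Finset ι} {c s : ι → Bool} {Y : Finset (ι → Bool)} {j : ι}
    (hj : j ∈ J) (hY : Y.card < J.card) (hs : s ∈ face J c) (hsY : s ∉ Y) :
    ∃ v, v j = (!s j) ∧ Joined (face J c \ Y) s v := by
  classical
  by_contra hcon
  push Not at hcon
  -- There are `|J|` routes from `s` to the other side: toggle `j` at once, or toggle some `l ≠ j`
  -- first. They share only `s`, so blocking all of them takes `|J|` deleted vertices.
  have key : ∀ l ∈ J, ∃ y ∈ Y, ((l = j ∧ y = toggle j s) ∨
      (l ≠ j ∧ (y = toggle l s ∨ y = toggle j (toggle l s)))) := by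
    intro l hl
    by_contra hno
    push Not at hno
    by_cases hlj : l = j
    · have h1 : toggle j s ∉ Y := fun h => (hno _ h).1 hlj rfl
      exact hcon (toggle j s) (by simp) (.step j ⟨hs, hsY⟩ ⟨toggle_mem_face hj hs, h1⟩)
    · have h1 : toggle l s ∉ Y := fun h => ((hno _ h).2 hlj).1 rfl
      have h2 : toggle j (toggle l s) ∉ Y := fun h => ((hno _ h).2 hlj).2 rfl
      have m1 := toggle_mem_face hl hs
      refine hcon (toggle j (toggle l s)) (by simp [toggle_of_ne (Ne.symm hlj)]) ?_
      exact (Joined.step (A := face J c \ Y) l ⟨hs, hsY⟩ ⟨m1, h1⟩).trans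
        (.step j ⟨m1, h1⟩ ⟨toggle_mem_face hj m1, h2⟩)
  choose! f hfY hf using key
  have hle := Finset.card_le_card_of_injOn f (s := J) (t := Y) (fun l hl => hfY l hl) (by
    intro l hl m hm e
    have a := hf l hl
    have b := hf m hm
    rw [← e] at b
    rcases a with ⟨rfl, a⟩ | ⟨hl', a | a⟩ <;> rcases b with ⟨rfl, b⟩ | ⟨hm', b | b⟩
    · rfl
    · exact toggle_dir_injective (a.symm.trans b)
    · exact absurd (toggle_injective _ (a.symm.trans b)).symm (toggle_ne_self _ _)
    · exact toggle_dir_injective (a.symm.trans b)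
    · exact toggle_dir_injective (a.symm.trans b)
    · exact absurd (b.symm.trans a) (toggle_toggle_ne_toggle (Ne.symm hm') _ _)
    · exact absurd (toggle_injective _ (a.symm.trans b)) (toggle_ne_self _ _)
    · exact absurd (a.symm.trans b) (toggle_toggle_ne_toggle (Ne.symm hl') _ _)
    · exact toggle_dir_injective (toggle_injective _ (a.symm.trans b)))
  omega

lemma card_filter_sides {ι : Type*} (Y : Finset (ι → Bool)) (j : ι) (b : Bool) :
    (Y.filter (fun v => v j = b)).card + (Y.filter (fun v => v j = !b)).card = Y.card := by
  rw [← Finset.card_filter_add_card_filter_not (s := Y) (fun v => v j = b)]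
  congr 2
  ext v
  simp only [Finset.mem_filter]
  cases v j <;> cases b <;> simp

/-- The graph of a face stays connected if fewer vertices than its dimension are removed. -/
lemma joined_face_diff {J : Finset ι} {c s t : ι → Bool} {Y : Finset (ι → Bool)}
    (hY : Y.card ≤ J.card - 1) (hs : s ∈ face J c) (hsY : s ∉ Y) (ht : t ∈ face J c)
    (htY : t ∉ Y) : Joined (face J c \ Y) s t := by
  induction hn : J.card generalizing J c s t Y with
  | zero =>
    have : s = t := by
      funext j
      have hj : j ∉ J := by rw [Finset.card_eq_zero.1 hn]; simp
      rw [hs j hj, ht j hj]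
    subst this
    exact .refl ⟨hs, hsY⟩
  | succ n ih =>
    obtain ⟨j, hj⟩ : J.Nonempty := Finset.card_pos.1 (by omega)
    have hJ : (J.erase j).card = n := by rw [Finset.card_erase_of_mem hj]; omega
    -- At most `n` vertices are deleted, so both sides cannot lose `n` of them; for `n = 0` nothing
    -- is deleted. Both ends are moved to the better side, where induction applies.
    obtain ⟨b, hb⟩ : ∃ b, (Y.filter (fun v => v j = b)).card ≤ n - 1 := by
      have := card_filter_sides Y j true
      by_contra! hcon
      have h1 := hcon true
      have h2 := hcon false
      simp only [Bool.not_true] at this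
      omega
    have move : ∀ u ∈ face J c, u ∉ Y → ∃ v, v j = b ∧ Joined (face J c \ Y) u v := by
      intro u hu huY
      by_cases hub : u j = b
      · exact ⟨u, hub, .refl ⟨hu, huY⟩⟩
      · obtain ⟨v, hv, h⟩ := exists_joined_opposite hj (by omega : Y.card < J.card) hu huY
        refine ⟨v, ?_, h⟩
        rw [hv]
        revert hub
        cases u j <;> cases b <;> simp
    obtain ⟨s', hs'b, hs'⟩ := move s hs hsY
    obtain ⟨t', ht'b, ht'⟩ := move t ht htY
    have := ih (J := J.erase j) (c := Function.update c j b) (s := s') (t := t')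
      (Y := Y.filter (fun v => v j = b)) (by omega) ((mem_facet hj).2 ⟨hs'.right_mem.1, hs'b⟩)
      (fun h => hs'.right_mem.2 (Finset.mem_filter.1 h).1)
      ((mem_facet hj).2 ⟨ht'.right_mem.1, ht'b⟩)
      (fun h => ht'.right_mem.2 (Finset.mem_filter.1 h).1) hJ
    refine hs'.trans ((this.mono ?_).trans ht'.symm)
    rintro v ⟨hv, hvY⟩
    obtain ⟨h1, h2⟩ := (mem_facet hj).1 hv
    exact ⟨h1, fun h => hvY (by simpa using ⟨h, h2⟩)⟩

/-- Only deletions on side `b` matter, and `|J| - 2` is one less than the dimension of the facet. -/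
lemma joined_facet_diff {J : Finset ι} {c s t : ι → Bool} {Y : Finset (ι → Bool)} {j : ι}
    (hj : j ∈ J) {b : Bool} (hY : (Y.filter (fun v => v j = b)).card ≤ J.card - 2)
    (hs : s ∈ face J c) (hsY : s ∉ Y) (hsb : s j = b) (ht : t ∈ face J c) (htY : t ∉ Y)
    (htb : t j = b) : Joined (face (J.erase j) (Function.update c j b) \ Y) s t := by
  have := joined_face_diff (J := J.erase j) (c := Function.update c j b) (s := s) (t := t)
      (Y := Y.filter (fun v => v j = b)) (by rw [Finset.card_erase_of_mem hj]; omega)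
      ((mem_facet hj).2 ⟨hs, hsb⟩) (fun h => hsY (Finset.mem_filter.1 h).1)
      ((mem_facet hj).2 ⟨ht, htb⟩) (fun h => htY (Finset.mem_filter.1 h).1)
  refine this.mono ?_
  rintro v ⟨hv, hvY⟩
  exact ⟨hv, fun h => hvY (by simpa using ⟨h, ((mem_facet hj).1 hv).2⟩)⟩

/-- If as many vertices as the dimension are removed from a face of dimension at least three, then
any two remaining vertices that are not isolated are joined. -/
lemma joined_face_diff_of_nonisolated {J : Finset ι} {c s t : ι → Bool} {Y : Finset (ι → Bool)}
    (hJ : 3 ≤ J.card) (hY : Y.card ≤ J.card) (hs : s ∈ face J c) (hsY : s ∉ Y)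
    (ht : t ∈ face J c) (htY : t ∉ Y) (hs' : ∃ l ∈ J, toggle l s ∉ Y)
    (ht' : ∃ l ∈ J, toggle l t ∉ Y) : Joined (face J c \ Y) s t := by
  obtain ⟨j, hj, hjs⟩ := hs'
  obtain ⟨l, hl, hlt⟩ := ht'
  have hsj : toggle j s ∈ face J c := toggle_mem_face hj hs
  have moves : ∀ b, ∃ s', s' j = b ∧ Joined (face J c \ Y) s s' := by
    intro b
    by_cases hb : s j = b
    · exact ⟨s, hb, .refl ⟨hs, hsY⟩⟩
    · refine ⟨toggle j s, ?_, .step j ⟨hs, hsY⟩ ⟨hsj, hjs⟩⟩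
      rw [toggle_same]
      revert hb
      cases s j <;> cases b <;> simp
  have hsum := card_filter_sides Y j (t j)
  -- Since `j` leads from `s` to a free neighbour, `s` can reach either side. If the side of `t` has
  -- few deletions, meet `t` there.
  by_cases hc : (Y.filter (fun v => v j = t j)).card ≤ J.card - 2
  · obtain ⟨s', hs'b, hs'⟩ := moves (t j)
    exact hs'.trans ((joined_facet_diff hj hc hs'.right_mem.1 hs'.right_mem.2 hs'b ht htY rfl).mono
      (Set.sdiff_subset_sdiff_left (facet_subset hj _)))
  -- Otherwise the far side has at most one deletion, so `t` can cross either at once or after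
  -- toggling `l`. The far facet stays connected because `1 ≤ |J| - 2`.
  · have hone : (Y.filter (fun v => v j = !t j)).card ≤ 1 := by omega
    obtain ⟨t', ht'b, ht'⟩ : ∃ t', t' j = (!t j) ∧ Joined (face J c \ Y) t t' := by
      by_cases h1 : toggle j t ∉ Y
      · exact ⟨_, toggle_same _ _, .step j ⟨ht, htY⟩ ⟨toggle_mem_face hj ht, h1⟩⟩
      have hlj : l ≠ j := by rintro rfl; exact h1 hlt
      have hlf := toggle_mem_face hl ht
      refine ⟨toggle j (toggle l t), by simp [toggle_of_ne hlj.symm], ?_⟩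
      refine (Joined.step (A := face J c \ Y) l ⟨ht, htY⟩ ⟨hlf, hlt⟩).trans
        (.step j ⟨hlf, hlt⟩ ⟨toggle_mem_face hj hlf, fun h2 => ?_⟩)
      refine toggle_ne_self l t (toggle_injective j ?_)
      refine Finset.card_le_one.1 hone _ ?_ _ ?_
      · simpa [toggle_of_ne hlj.symm] using h2
      · simpa using h1
    obtain ⟨s', hs'b, hs'⟩ := moves (!t j)
    exact hs'.trans (((joined_facet_diff hj (by omega) hs'.right_mem.1
      hs'.right_mem.2 hs'b ht'.right_mem.1 ht'.right_mem.2 ht'b).mono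
      (Set.sdiff_subset_sdiff_left (facet_subset hj _))).trans ht'.symm)

/-- A neighbour of `u` has a further neighbour avoiding a given vertex and the closed
neighbourhood of `u`. -/
lemma exists_toggle_notMem_nhd {J : Finset ι} (hJ : 3 ≤ J.card) (j : ι) (u w : ι → Bool) :
    ∃ l ∈ J, toggle l (toggle j u) ≠ u ∧ toggle l (toggle j u) ≠ w ∧
      ∀ m, toggle l (toggle j u) ≠ toggle m u := by
  have hc : 1 < (J.erase j).card := by
    have := Finset.pred_card_le_card_erase (s := J) (a := j)
    omega
  obtain ⟨l, hl, l', hl', hne⟩ := Finset.one_lt_card.1 hc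
  have aux : ∀ l ∈ J.erase j, toggle l (toggle j u) ≠ u ∧
      ∀ m, toggle l (toggle j u) ≠ toggle m u := fun l hl =>
    ⟨fun e => Finset.ne_of_mem_erase hl (toggle_dir_injective (eq_toggle_comm e.symm)).symm,
      fun m => toggle_toggle_ne_toggle (Finset.ne_of_mem_erase hl) m u⟩
  by_cases h : toggle l (toggle j u) = w
  · exact ⟨l', Finset.mem_of_mem_erase hl', (aux l' hl').1,
      fun h' => hne (toggle_dir_injective (h.trans h'.symm)), (aux l' hl').2⟩
  · exact ⟨l, Finset.mem_of_mem_erase hl, (aux l hl).1, h, (aux l hl).2⟩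

end Connectivity

/-! ### Directions used by few edges between given vertices -/

section Directions

/-- Distinct vertices of the cube are distinguished by fewer coordinates than there are
vertices. -/
lemma exists_separating_coordinates (X : Finset (ι → Bool)) :
    ∃ D : Finset ι, D.card ≤ X.card - 1 ∧
      ∀ u ∈ X, ∀ v ∈ X, (∀ j ∈ D, u j = v j) → u = v := by
  classical
  induction X using Finset.induction_on with
  | empty => exact ⟨∅, by simp⟩
  | @insert a X ha ih =>
    obtain ⟨D, hD, h⟩ := ih
    rw [Finset.card_insert_of_notMem ha]
    -- As `D` separates `X`, the new vertex agrees on `D` with at most one old vertex, so one more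
    -- coordinate suffices.
    by_cases hcon : ∃ v ∈ X, ∀ j ∈ D, a j = v j
    · obtain ⟨v, hv, hav⟩ := hcon
      obtain ⟨j, hj⟩ : ∃ j, a j ≠ v j := by
        by_contra! hall
        exact ha (by rw [funext hall]; exact hv)
      have hX : 0 < X.card := Finset.card_pos.2 ⟨v, hv⟩
      have haux : ∀ w ∈ X, (∀ l ∈ insert j D, a l = w l) → False := by
        intro w hw haw
        have : w = v := h w hw v hv fun l hl => by
          rw [← haw l (Finset.mem_insert_of_mem hl), hav l hl]
        exact hj (by rw [haw j (Finset.mem_insert_self _ _), this])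
      refine ⟨insert j D, (Finset.card_insert_le _ _).trans (by omega), ?_⟩
      intro u hu w hw huw
      rcases Finset.mem_insert.1 hu with rfl | hu' <;> rcases Finset.mem_insert.1 hw with rfl | hw'
      · rfl
      · exact (haux w hw' huw).elim
      · exact (haux u hu' fun l hl => (huw l hl).symm).elim
      · exact h u hu' w hw' fun l hl => huw l (Finset.mem_insert_of_mem hl)
    · push Not at hcon
      refine ⟨D, by omega, ?_⟩
      intro u hu w hw huw
      rcases Finset.mem_insert.1 hu with rfl | hu' <;> rcases Finset.mem_insert.1 hw with rfl | hw'
      · rfl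
      · obtain ⟨l, hl, hne⟩ := hcon w hw'
        exact absurd (huw l hl) hne
      · obtain ⟨l, hl, hne⟩ := hcon u hu'
        exact absurd (huw l hl).symm hne
      · exact h u hu' w hw' huw

/-- Take a direction outside a separating set of coordinates: the ends of an edge in that direction
would agree on the whole separating set. -/
lemma exists_direction_of_card_lt {X : Finset (ι → Bool)} {I : Finset ι}
    (h : X.card - 1 < I.card) : ∃ i ∈ I, ∀ u ∈ X, toggle i u ∉ X := by
  obtain ⟨D, hD, hX⟩ := exists_separating_coordinates X
  obtain ⟨i, hi, hiD⟩ := Finset.exists_mem_notMem_of_card_lt_card (hD.trans_lt h)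
  refine ⟨i, hi, fun u hu hu' => toggle_ne_self i u (hX _ hu' _ hu fun j hj => ?_)⟩
  exact toggle_of_ne (by rintro rfl; exact hiD hj) u

/-- Among at most `|I| + 1` vertices, some direction in `I` is used by at most one edge. -/
lemma exists_direction_at_most_one {X : Finset (ι → Bool)} {I : Finset ι} (hI : I.Nonempty)
    (h : X.card ≤ I.card + 1) : ∃ i ∈ I, ∀ u ∈ X, toggle i u ∈ X → ∀ v ∈ X, toggle i v ∈ X →
      v = u ∨ v = toggle i u := by
  classical
  by_contra! hcon
  obtain ⟨i, hi⟩ := hI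
  obtain ⟨u, hu, hu', v, hv, hv', hvu, hvu'⟩ := hcon i hi
  -- Collapsing direction `i` merges two pairs of vertices, so the image of `X` has at most `|X| - 2
  -- ≤ |I| - 1` elements. Some other direction `j` then carries no edge in the image, whereas every
  -- edge of `X` in direction `j` survives the collapse.
  let f : (ι → Bool) → (ι → Bool) := fun w => Function.update w i false
  have hf : ∀ w, f (toggle i w) = f w := fun w => by simp [f, toggle]
  let X' := (X.erase (toggle i u)).erase (toggle i v)
  have hX' : ∀ w ∈ X, f w ∈ X'.image f := by
    have huv' : u ≠ toggle i v := fun e => hvu' (eq_toggle_comm e)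
    intro w hw
    by_cases h1 : w = toggle i u
    · rw [h1, hf]
      exact Finset.mem_image_of_mem f (Finset.mem_erase.2 ⟨huv',
        Finset.mem_erase.2 ⟨(toggle_ne_self i u).symm, hu⟩⟩)
    by_cases h2 : w = toggle i v
    · rw [h2, hf]
      exact Finset.mem_image_of_mem f (Finset.mem_erase.2 ⟨(toggle_ne_self i v).symm,
        Finset.mem_erase.2 ⟨hvu', hv⟩⟩)
    exact Finset.mem_image_of_mem f (Finset.mem_erase.2 ⟨h2, Finset.mem_erase.2 ⟨h1, hw⟩⟩)
  have hcard : X'.card + 2 = X.card := by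
    have h1 : toggle i v ∈ X.erase (toggle i u) :=
      Finset.mem_erase.2 ⟨fun e => hvu (toggle_injective i e), hv'⟩
    have : X'.card + 1 = _ := Finset.card_erase_add_one h1
    have := Finset.card_erase_add_one hu'
    omega
  have hpos : 0 < (X'.image f).card := Finset.card_pos.2 ⟨_, hX' u hu⟩
  have hle : (X'.image f).card ≤ X'.card := Finset.card_image_le
  have hIc := Finset.card_erase_add_one hi
  obtain ⟨j, hj, hjX⟩ := exists_direction_of_card_lt (X := X'.image f) (I := I.erase i) (by omega)
  obtain ⟨w, hw, hw', -⟩ := hcon j (Finset.mem_of_mem_erase hj)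
  refine hjX _ (hX' w hw) ?_
  have : toggle j (f w) = f (toggle j w) := by
    have hji := Finset.ne_of_mem_erase hj
    simp only [f, toggle, Function.update_of_ne hji]
    exact (Function.update_comm hji _ _ _).symm
  rw [this]
  exact hX' _ hw'

end Directions

end CubeGraph

/-! ### Linkages, and the two induction steps -/

namespace CubeGraph

variable {ι κ : Type*} [DecidableEq ι]

/-- Replacing the `i`-th coordinate by `b` is the identity or the toggling of `i`. -/
lemma update_eq_or (i : ι) (b : Bool) (v : ι → Bool) :
    (v i = b ∧ Function.update v i b = v) ∨ (v i = (!b) ∧ Function.update v i b = toggle i v) := by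
  by_cases h : v i = b
  · exact .inl ⟨h, by rw [← h, Function.update_eq_self]⟩
  · have h' : v i = !b := by revert h; cases v i <;> cases b <;> simp
    exact .inr ⟨h', by simp [toggle, h']⟩

lemma update_mem_facet {I : Finset ι} {c v : ι → Bool} {i : ι} (hi : i ∈ I) (hv : v ∈ face I c)
    (b : Bool) : Function.update v i b ∈ face (I.erase i) (Function.update c i b) := by
  rw [mem_facet hi]
  refine ⟨?_, by simp⟩
  rcases update_eq_or i b v with ⟨_, h⟩ | ⟨_, h⟩ <;> rw [h]
  · exact hv
  · exact toggle_mem_face hi hv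

/-- The terminals `x a p`, `a ∈ K`, are pairwise distinct; `x a false` and `x a true` form the
pair with index `a`. -/
def Distinct (K : Finset κ) (x : κ → Bool → ι → Bool) : Prop :=
  ∀ a ∈ K, ∀ b ∈ K, ∀ p q, x a p = x b q → a = b ∧ p = q

/-- The pairs indexed by `K` are joined by disjoint walks inside `A`. -/
def Link (A : Set (ι → Bool)) (K : Finset κ) (x : κ → Bool → ι → Bool) : Prop :=
  ∃ C : κ → Set (ι → Bool), (∀ a ∈ K, C a ⊆ A ∧ Joined (C a) (x a false) (x a true)) ∧
    ∀ a ∈ K, ∀ b ∈ K, a ≠ b → Disjoint (C a) (C b)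

/-- The set of terminals. -/
def terms (K : Finset κ) (x : κ → Bool → ι → Bool) : Set (ι → Bool) :=
  {v | ∃ a ∈ K, ∃ p, x a p = v}

variable (κ) in
/-- Every `k` pairs of vertices of a face with directions `I` can be linked in this face. -/
def Linked (I : Finset ι) (k : ℕ) : Prop :=
  ∀ (c : ι → Bool) (K : Finset κ) (x : κ → Bool → ι → Bool), K.card = k → Distinct K x →
    (∀ a ∈ K, ∀ p, x a p ∈ face I c) → Link (face I c) K x

variable (κ) in
/-- Every `k` pairs of vertices of a face with directions `I` can be linked in this face avoiding
any further vertex. -/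
def StrongLinked (I : Finset ι) (k : ℕ) : Prop :=
  ∀ (c : ι → Bool) (K : Finset κ) (x : κ → Bool → ι → Bool) (Z : Set (ι → Bool)), K.card = k →
    Distinct K x → (∀ a ∈ K, ∀ p, x a p ∈ face I c) → Z.Subsingleton →
    (∀ a ∈ K, ∀ p, x a p ∉ Z) → Link (face I c \ Z) K x

lemma Distinct.mono {ι κ : Type*} {K K' : Finset κ} {x : κ → Bool → ι → Bool}
    (h : Distinct K x) (hK : K' ⊆ K) : Distinct K' x := fun a ha b hb => h a (hK ha) b (hK hb)

lemma Link.mono {A B : Set (ι → Bool)} {K : Finset κ} {x : κ → Bool → ι → Bool}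
    (h : Link A K x) (hAB : A ⊆ B) : Link B K x := by
  obtain ⟨C, hC, hd⟩ := h
  exact ⟨C, fun a ha => ⟨(hC a ha).1.trans hAB, (hC a ha).2⟩, hd⟩

lemma exists_finset_terms {ι κ : Type*} (K : Finset κ) (x : κ → Bool → ι → Bool) (hx : Distinct K x) :
    ∃ X : Finset (ι → Bool), (∀ v, v ∈ X ↔ v ∈ terms K x) ∧ X.card = 2 * K.card := by
  classical
  refine ⟨(K ×ˢ Finset.univ).image (fun p : κ × Bool => x p.1 p.2), fun v => ?_, ?_⟩
  · simp only [Finset.mem_image, Finset.mem_product, Finset.mem_univ, and_true, Prod.exists, terms,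
      Set.mem_ofPred_eq]
    constructor
    · rintro ⟨a, p, ha, h⟩; exact ⟨a, ha, p, h⟩
    · rintro ⟨a, ha, p, h⟩; exact ⟨a, p, ha, h⟩
  · rw [Finset.card_image_of_injOn, Finset.card_product]
    · simp [mul_comm]
    · rintro ⟨a, p⟩ ha ⟨b, q⟩ hb h
      simp only [Finset.coe_product, Set.mem_prod, Finset.mem_coe] at ha hb
      obtain ⟨h1, h2⟩ := hx a ha.1 b hb.1 p q h
      rw [h1, h2]

/-- A linkage of the projections of the terminals to a facet extends to the terminals. -/
lemma Link.of_facet {I : Finset ι} {c : ι → Bool} {i : ι} (hi : i ∈ I) {b : Bool} {K : Finset κ}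
    {x : κ → Bool → ι → Bool} {Z : Set (ι → Bool)} (hx : Distinct K x)
    (h : Link (face (I.erase i) (Function.update c i b) \ Z) K
      (fun a p => Function.update (x a p) i b)) :
    Link ((face (I.erase i) (Function.update c i b) \ Z) ∪ terms K x) K x := by
  obtain ⟨C, hC, hd⟩ := h
  have hend : ∀ a ∈ K, ∀ p, Function.update (x a p) i b ∈ C a := by
    intro a ha p
    cases p
    · exact (hC a ha).2.left_mem
    · exact (hC a ha).2.right_mem
  -- A terminal inside the facet is its own projection, hence already lies in the set of its own
  -- pair.
  have hmem : ∀ a ∈ K, ∀ p, ∀ a' ∈ K, x a p ∈ C a' → a = a' := by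
    intro a ha p a' ha' h
    by_contra hne
    have h1 := ((mem_facet hi).1 ((hC a' ha').1 h).1).2
    have h2 := hend a ha p
    rw [← h1, Function.update_eq_self] at h2
    exact Set.disjoint_left.1 (hd a ha a' ha' hne) h2 h
  refine ⟨fun a => C a ∪ {v | ∃ p, x a p = v}, fun a ha => ⟨?_, ?_⟩, ?_⟩
  · rintro v (hv | ⟨p, rfl⟩)
    · exact .inl ((hC a ha).1 hv)
    · exact .inr ⟨a, ha, p, rfl⟩
  · have hstep : ∀ p, Joined (C a ∪ {v | ∃ p, x a p = v}) (x a p)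
        (Function.update (x a p) i b) := by
      intro p
      have h1 : x a p ∈ C a ∪ {v | ∃ p, x a p = v} := .inr ⟨p, rfl⟩
      have h2 := hend a ha p
      rcases update_eq_or i b (x a p) with ⟨_, h⟩ | ⟨_, h⟩ <;> rw [h] at h2 ⊢
      · exact .refl h1
      · exact .step i h1 (.inl h2)
    exact (hstep false).trans (((hC a ha).2.mono Set.subset_union_left).trans (hstep true).symm)
  · intro a ha a' ha' hne
    rw [Set.disjoint_left]
    rintro v (hv | ⟨p, rfl⟩) (hv' | ⟨q, hq⟩)
    · exact Set.disjoint_left.1 (hd a ha a' ha' hne) hv hv'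
    · exact hne (hmem a' ha' q a ha (by rwa [hq])).symm
    · exact hne (hmem a ha p a' ha' hv')
    · exact hne (hx a' ha' a ha q p hq).1.symm

/-- Projecting along a direction not used by edges between terminals keeps them distinct. -/
lemma Distinct.update {K : Finset κ} {x : κ → Bool → ι → Bool} (hx : Distinct K x) {i : ι}
    (hi : ∀ u ∈ terms K x, toggle i u ∉ terms K x) (b : Bool) :
    Distinct K (fun a p => Function.update (x a p) i b) := by
  intro a ha a' ha' p q h
  have hu : x a p ∈ terms K x := ⟨a, ha, p, rfl⟩
  have hu' : x a' q ∈ terms K x := ⟨a', ha', q, rfl⟩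
  apply hx a ha a' ha' p q
  simp only at h
  rcases update_eq_or i b (x a p) with ⟨_, h1⟩ | ⟨_, h1⟩ <;>
    rcases update_eq_or i b (x a' q) with ⟨_, h2⟩ | ⟨_, h2⟩ <;> rw [h1, h2] at h
  · exact h
  · exact absurd (h ▸ hu) (hi _ hu')
  · exact absurd (h ▸ hu') (hi _ hu)
  · exact toggle_injective i h

/-- The linkage is built in the facet opposite to the forbidden vertex. Outside that facet it uses
only terminals, which are not forbidden. -/
lemma strongLinked_of_linked_facets {I : Finset ι} {k : ℕ} (hI : I.card = 2 * k) (hk : 0 < k)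
    (hL : ∀ i ∈ I, Linked κ (I.erase i) k) : StrongLinked κ I k := by
  intro c K x Z hK hx hmem hZ hxZ
  obtain ⟨z, hz⟩ : ∃ z, Z ⊆ {z} := by
    rcases hZ.eq_empty_or_singleton with rfl | ⟨z, rfl⟩
    · exact ⟨c, by simp⟩
    · exact ⟨z, subset_rfl⟩
  obtain ⟨X, hX, hXc⟩ := exists_finset_terms K x hx
  obtain ⟨i, hi, hiX⟩ := exists_direction_of_card_lt (X := X) (I := I) (by omega)
  have := hL i hi (Function.update c i (!z i)) K (fun a p => Function.update (x a p) i (!z i)) hK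
    (hx.update (fun u hu hu' => hiX u ((hX u).2 hu) ((hX _).2 hu')) _)
    (fun a ha p => update_mem_facet hi (hmem a ha p) _)
  rw [← Set.sdiff_empty (s := face (I.erase i) _)] at this
  refine (Link.of_facet hi hx this).mono ?_
  rintro v (hv | ⟨a, ha, p, rfl⟩)
  · obtain ⟨h1, h2⟩ := (mem_facet hi).1 hv.1
    refine ⟨h1, fun h => ?_⟩
    rw [hz h] at h2
    simp at h2
  · exact ⟨hmem a ha p, hxZ a ha p⟩

/-- Linking one pair in (or through) the facet on side `b`, and all others in the opposite one. -/
lemma link_of_split [DecidableEq κ] {I : Finset ι} {k : ℕ} {c : ι → Bool} {K : Finset κ}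
    {x : κ → Bool → ι → Bool} {i : ι} (hi : i ∈ I) (hS : StrongLinked κ (I.erase i) k)
    {a₀ : κ} (hK : (K.erase a₀).card = k) (ha₀ : a₀ ∈ K) (hx : Distinct K x)
    (hmem : ∀ a ∈ K, ∀ p, x a p ∈ face I c)
    (hY : ∀ u ∈ terms (K.erase a₀) x, toggle i u ∉ terms (K.erase a₀) x) {b p : Bool}
    (hb : x a₀ p i = b)
    (hb' : x a₀ (!p) i = (!b) → toggle i (x a₀ (!p)) ∉ terms (K.erase a₀) x)
    (hJ : Joined (face (I.erase i) (Function.update c i b) \ terms (K.erase a₀) x) (x a₀ p)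
      (Function.update (x a₀ (!p)) i b)) :
    Link (face I c) K x := by
  have hsub : K.erase a₀ ⊆ K := Finset.erase_subset _ _
  have hterm : ∀ q, x a₀ q ∉ terms (K.erase a₀) x := by
    rintro q ⟨a, ha, p, h⟩
    exact Finset.ne_of_mem_erase ha (hx a (hsub ha) a₀ ha₀ p q h).1
  -- The vertex avoided by the other pairs is the second end of the pair `a₀` if it lies on their
  -- side; otherwise `Z` is empty.
  let Z : Set (ι → Bool) := {v | v = x a₀ (!p) ∧ v i = !b}
  have hL := hS (Function.update c i (!b)) (K.erase a₀)
    (fun a p => Function.update (x a p) i (!b)) Z hK ((hx.mono hsub).update hY _)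
    (fun a ha p => update_mem_facet hi (hmem a (hsub ha) p) _)
    (fun u hu v hv => hu.1.trans hv.1.symm) (by
      rintro a ha q ⟨h1, h2⟩
      have hat : x a q ∈ terms (K.erase a₀) x := ⟨a, ha, q, rfl⟩
      rcases update_eq_or i (!b) (x a q) with ⟨_, h⟩ | ⟨_, h⟩ <;> rw [h] at h1 h2
      · exact hterm _ (h1 ▸ hat)
      · refine hb' (h1 ▸ h2) ?_
        rwa [← h1, toggle_toggle])
  obtain ⟨C, hC, hd⟩ := Link.of_facet hi (hx.mono hsub) hL
  let C₀ : Set (ι → Bool) :=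
    (face (I.erase i) (Function.update c i b) \ terms (K.erase a₀) x) ∪ {x a₀ (!p)}
  have hC₀ : Joined C₀ (x a₀ p) (x a₀ (!p)) := by
    refine (hJ.mono Set.subset_union_left).trans ?_
    have h1 : x a₀ (!p) ∈ C₀ := .inr rfl
    have h2 : Function.update (x a₀ (!p)) i b ∈ C₀ := .inl hJ.right_mem
    rcases update_eq_or i b (x a₀ (!p)) with ⟨_, h⟩ | ⟨_, h⟩ <;> rw [h] at h2 ⊢
    · exact .refl h1
    · exact (Joined.step i h1 h2).symm
  have hdis : ∀ a ∈ K.erase a₀, Disjoint C₀ (C a) := by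
    intro a ha
    rw [Set.disjoint_left]
    rintro v (⟨hv, hvY⟩ | rfl) hva
    · rcases (hC a ha).1 hva with h | h
      · have h1 := ((mem_facet hi).1 h.1).2
        rw [((mem_facet hi).1 hv).2] at h1
        simp at h1
      · exact hvY h
    · rcases (hC a ha).1 hva with h | h
      · exact h.2 ⟨rfl, ((mem_facet hi).1 h.1).2⟩
      · exact hterm _ h
  refine ⟨Function.update C a₀ C₀, fun a ha => ?_, fun a ha a' ha' hne => ?_⟩
  · by_cases h : a = a₀
    · subst h
      rw [Function.update_self]
      refine ⟨?_, ?_⟩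
      · rintro v (hv | rfl)
        · exact facet_subset hi _ hv.1
        · exact hmem a ha _
      · cases p
        · exact hC₀
        · exact hC₀.symm
    · rw [Function.update_of_ne h]
      have ha' := Finset.mem_erase.2 ⟨h, ha⟩
      refine ⟨?_, (hC a ha').2⟩
      intro v hv
      rcases (hC a ha').1 hv with h | ⟨a', ha', q, rfl⟩
      · exact facet_subset hi _ h.1
      · exact hmem a' (hsub ha') q
  · by_cases h : a = a₀
    · subst h
      rw [Function.update_self, Function.update_of_ne hne.symm]
      exact hdis a' (Finset.mem_erase.2 ⟨hne.symm, ha'⟩)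
    · rw [Function.update_of_ne h]
      by_cases h' : a' = a₀
      · subst h'
        rw [Function.update_self]
        exact (hdis a (Finset.mem_erase.2 ⟨h, ha⟩)).symm
      · rw [Function.update_of_ne h']
        exact hd a (Finset.mem_erase.2 ⟨h, ha⟩) a' (Finset.mem_erase.2 ⟨h', ha'⟩) hne

/-- If the chosen direction contains an edge between terminals, the pair singled out is one meeting
that edge. Otherwise any pair will do as soon as some terminal of another pair lies opposite to one
of its ends. The remaining case, all terminals in one `2k`-dimensional facet, needs `2k ≥ 3`, hence
`k ≥ 2`. -/
lemma linked_of_strongLinked_facets [DecidableEq κ] {I : Finset ι} {k : ℕ} (hk : 2 ≤ k)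
    (hI : I.card = 2 * k + 1) (hS : ∀ i ∈ I, StrongLinked κ (I.erase i) k) :
    Linked κ I (k + 1) := by
  classical
  intro c K x hK hx hmem
  obtain ⟨X, hX, hXc⟩ := exists_finset_terms K x hx
  obtain ⟨i, hi, hiX⟩ := exists_direction_at_most_one (X := X) (I := I)
    (Finset.card_pos.1 (by omega)) (by omega)
  have hJ : (I.erase i).card = 2 * k := by rw [Finset.card_erase_of_mem hi]; omega
  have hKe : ∀ a ∈ K, (K.erase a).card = k := fun a ha => by
    rw [Finset.card_erase_of_mem ha]; omega
  have hXm : ∀ a ∈ K, ∀ p, x a p ∈ X := fun a ha p => (hX _).2 ⟨a, ha, p, rfl⟩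
  have hsub : ∀ a, ∀ v ∈ terms (K.erase a) x, v ∈ X := by
    rintro a v ⟨a', ha', p, rfl⟩
    exact hXm a' (Finset.mem_of_mem_erase ha') p
  have hnot : ∀ a ∈ K, ∀ p, x a p ∉ terms (K.erase a) x := by
    rintro a ha p ⟨a', ha', q, h⟩
    exact Finset.ne_of_mem_erase ha' (hx a' (Finset.mem_of_mem_erase ha') a ha q p h).1
  have hmemX : ∀ v ∈ X, ∀ a ∈ K, v ∉ terms (K.erase a) x → ∃ p, x a p = v := by
    intro v hv a ha hva
    obtain ⟨a', ha', p, h⟩ := (hX v).1 hv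
    by_cases haa : a' = a
    · exact ⟨p, haa ▸ h⟩
    · exact absurd ⟨a', Finset.mem_erase.2 ⟨haa, ha'⟩, p, h⟩ hva
  -- Linking the pair `a` in the facet on side `b` when it misses one of the other terminals.
  have hjoin : ∀ a ∈ K, ∀ b p, x a p i = b →
      Function.update (x a (!p)) i b ∉ terms (K.erase a) x →
      (∃ v ∈ terms (K.erase a) x, v i = !b) →
      Joined (face (I.erase i) (Function.update c i b) \ terms (K.erase a) x) (x a p)
        (Function.update (x a (!p)) i b) := by
    rintro a ha b p hb hne ⟨v, hv, hvb⟩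
    obtain ⟨Y, hY, hYc⟩ := exists_finset_terms (K.erase a) x (hx.mono (Finset.erase_subset _ _))
    have e : terms (K.erase a) x = (Y : Set (ι → Bool)) := by ext v; exact (hY v).symm
    rw [hKe a ha] at hYc
    have hf := card_filter_sides Y i b
    have hpos : 0 < (Y.filter (fun v => v i = !b)).card :=
      Finset.card_pos.2 ⟨v, Finset.mem_filter.2 ⟨(hY v).2 hv, hvb⟩⟩
    have hu := (mem_facet hi).1 (update_mem_facet hi (hmem a ha (!p)) b)
    have hp := hnot a ha p
    rw [e] at hne hp ⊢
    exact joined_facet_diff hi (by omega) (hmem a ha p) hp hb hu.1 hne hu.2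
  by_cases hE : ∃ u ∈ X, toggle i u ∈ X
  · obtain ⟨u, hu, hu'⟩ := hE
    obtain ⟨a, ha, p, rfl⟩ := (hX u).1 hu
    have hY : ∀ v ∈ terms (K.erase a) x, toggle i v ∉ terms (K.erase a) x := by
      intro v hv hv'
      rcases hiX _ hu hu' v (hsub a v hv) (hsub a _ hv') with rfl | rfl
      · exact hnot a ha p hv
      · rw [toggle_toggle] at hv'
        exact hnot a ha p hv'
    have hb' : toggle i (x a (!p)) ∉ terms (K.erase a) x := by
      intro h
      rcases hiX _ hu hu' _ (hXm a ha (!p)) (hsub a _ h) with h1 | h1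
      · simpa using (hx a ha a ha _ _ h1).2
      · rw [h1, toggle_toggle] at h
        exact hnot a ha p h
    refine link_of_split hi (hS i hi) (hKe a ha) ha hx hmem hY rfl (fun _ => hb') ?_
    -- If the other end of the edge belongs to a different pair, it lies on the opposite side and
    -- leaves at most `2k - 1` obstacles in the facet. Otherwise it is the partner, whose projection
    -- is `x a p` itself.
    by_cases h : toggle i (x a p) ∈ terms (K.erase a) x
    · refine hjoin a ha _ p rfl ?_ ⟨_, h, by simp⟩
      rcases update_eq_or i (x a p i) (x a (!p)) with ⟨_, e⟩ | ⟨_, e⟩ <;> rw [e]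
      · exact hnot a ha _
      · exact hb'
    · obtain ⟨q, hq⟩ := hmemX _ hu' a ha h
      have hqp : q = !p := by
        by_contra hne
        have : q = p := by revert hne; cases p <;> cases q <;> simp
        exact toggle_ne_self i (x a p) (by rw [← hq, this])
      have : Function.update (x a (!p)) i (x a p i) = x a p := by
        rw [← hqp, hq]; simp [toggle]
      rw [this]
      exact .refl ⟨(mem_facet hi).2 ⟨hmem a ha p, rfl⟩, hnot a ha p⟩
  · push Not at hE
    have hY : ∀ a, ∀ v ∈ terms (K.erase a) x, toggle i v ∉ terms (K.erase a) x :=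
      fun a v hv hv' => hE v (hsub a v hv) (hsub a _ hv')
    have hb' : ∀ a ∈ K, ∀ p, toggle i (x a p) ∉ terms (K.erase a) x :=
      fun a ha p h => hE _ (hXm a ha p) (hsub a _ h)
    have hupd : ∀ a ∈ K, ∀ p b, Function.update (x a p) i b ∉ terms (K.erase a) x := by
      intro a ha p b
      rcases update_eq_or i b (x a p) with ⟨_, e⟩ | ⟨_, e⟩ <;> rw [e]
      · exact hnot a ha _
      · exact hb' a ha p
    have hdone : ∀ a ∈ K, ∀ p, (∃ v ∈ terms (K.erase a) x, v i = !(x a p i)) →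
        Link (face I c) K x := fun a ha p h =>
      link_of_split hi (hS i hi) (hKe a ha) ha hx hmem (hY a) rfl (fun _ => hb' a ha _)
        (hjoin a ha _ p rfl (hupd a ha _ _) h)
    by_contra hcon
    obtain ⟨a₀, ha₀⟩ : K.Nonempty := Finset.card_pos.1 (by omega)
    obtain ⟨a₁, ha₁⟩ : (K.erase a₀).Nonempty :=
      Finset.card_pos.1 (by rw [hKe a₀ ha₀]; omega)
    have hne := Finset.ne_of_mem_erase ha₁
    replace ha₁ := Finset.mem_of_mem_erase ha₁
    have hside : ∀ a ∈ K, ∀ a' ∈ K, a ≠ a' → ∀ p q, x a p i = x a' q i := by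
      intro a ha a' ha' hne p q
      by_contra h
      refine hcon (hdone a' ha' q ⟨x a p, ⟨a, Finset.mem_erase.2 ⟨hne, ha⟩, p, rfl⟩, ?_⟩)
      revert h
      cases x a p i <;> cases x a' q i <;> simp
    have hall : ∀ a ∈ K, ∀ p q, x a p i = x a q i := by
      intro a ha p q
      obtain ⟨a', ha', hne'⟩ : ∃ a' ∈ K, a ≠ a' := by
        by_cases h : a = a₀
        · exact ⟨a₁, ha₁, h ▸ hne.symm⟩
        · exact ⟨a₀, ha₀, h⟩
      rw [hside a ha a' ha' hne' p true, hside a ha a' ha' hne' q true]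
    -- All terminals lie in one facet.
    have hfree : ∀ a ∈ K, (∀ q, ∃ l ∈ I.erase i, toggle l (x a q) ∉ terms (K.erase a) x) →
        False := by
      intro a ha hq
      obtain ⟨Y, hY', hYc⟩ := exists_finset_terms (K.erase a) x (hx.mono (Finset.erase_subset _ _))
      have e : terms (K.erase a) x = (Y : Set (ι → Bool)) := by ext v; exact (hY' v).symm
      rw [hKe a ha] at hYc
      refine hcon (link_of_split (p := false) hi (hS i hi) (hKe a ha) ha hx hmem (hY a) rfl
        (fun _ => hb' a ha _) ?_)
      have h1 := hall a ha true false
      have h2 : Function.update (x a (!false)) i (x a false i) = x a true := by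
        rw [← h1]; exact Function.update_eq_self _ _
      have n0 := hnot a ha false
      have n1 := hnot a ha true
      rw [h2]
      rw [e] at hq n0 n1 ⊢
      exact joined_face_diff_of_nonisolated (by omega) (by omega)
        ((mem_facet hi).2 ⟨hmem a ha _, rfl⟩) n0 ((mem_facet hi).2 ⟨hmem a ha _, h1⟩) n1
        (hq false) (hq true)
    -- If the pair `a₀` fails, one of its ends is isolated: its `2k` neighbours in the facet are
    -- exactly the `2k` other terminals. A terminal of `a₁` is then such a neighbour, and it has a
    -- neighbour at distance two from the isolated end, different from the partner and so not a
    -- terminal. Hence `a₁` succeeds.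
    obtain ⟨p, hp⟩ : ∃ p, ∀ l ∈ I.erase i, toggle l (x a₀ p) ∈ terms (K.erase a₀) x := by
      by_contra! h
      exact hfree a₀ ha₀ h
    have hnbr : ∀ v ∈ terms (K.erase a₀) x, ∃ j, v = toggle j (x a₀ p) := by
      obtain ⟨Y, hY', hYc⟩ :=
        exists_finset_terms (K.erase a₀) x (hx.mono (Finset.erase_subset _ _))
      rw [hKe a₀ ha₀] at hYc
      have himg : (I.erase i).image (fun l => toggle l (x a₀ p)) = Y := by
        apply Finset.eq_of_subset_of_card_le
        · intro v hv
          obtain ⟨l, hl, rfl⟩ := Finset.mem_image.1 hv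
          exact (hY' _).2 (hp l hl)
        · rw [Finset.card_image_of_injective _ (fun _ _ h => toggle_dir_injective h)]
          omega
      intro v hv
      rw [← hY', ← himg] at hv
      obtain ⟨l, _, rfl⟩ := Finset.mem_image.1 hv
      exact ⟨l, rfl⟩
    refine hfree a₁ ha₁ fun q => ?_
    obtain ⟨j, hj⟩ := hnbr (x a₁ q) ⟨a₁, Finset.mem_erase.2 ⟨hne, ha₁⟩, q, rfl⟩
    obtain ⟨l, hl, h1, h2, h3⟩ := exists_toggle_notMem_nhd (J := I.erase i) (by omega) j (x a₀ p)
      (x a₀ (!p))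
    refine ⟨l, hl, fun h => ?_⟩
    rw [hj] at h
    by_cases hm : toggle l (toggle j (x a₀ p)) ∈ terms (K.erase a₀) x
    · obtain ⟨m, hm⟩ := hnbr _ hm
      exact h3 m hm
    · obtain ⟨q', hq'⟩ := hmemX _ (hsub _ _ h) a₀ ha₀ hm
      by_cases hqp : q' = p
      · exact h1 (by rw [← hq', hqp])
      · refine h2 ?_
        rw [← hq']
        congr 1
        revert hqp
        cases p <;> cases q' <;> simp

end CubeGraph

/-! ### Two pairs and a forbidden vertex in a four-dimensional face -/

namespace CubeGraph

variable {ι κ : Type*} [DecidableEq ι]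

/-- The pairs `s₁, t₁` and `s₂, t₂` are joined by disjoint walks inside `A`. -/
def LinkTwo (A : Set (ι → Bool)) (s₁ t₁ s₂ t₂ : ι → Bool) : Prop :=
  ∃ C₁ C₂ : Set (ι → Bool), C₁ ⊆ A ∧ C₂ ⊆ A ∧ Disjoint C₁ C₂ ∧ Joined C₁ s₁ t₁ ∧ Joined C₂ s₂ t₂

namespace LinkTwo

variable {A : Set (ι → Bool)} {s₁ t₁ s₂ t₂ : ι → Bool}

lemma swap (h : LinkTwo A s₁ t₁ s₂ t₂) : LinkTwo A s₂ t₂ s₁ t₁ := by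
  obtain ⟨C₁, C₂, h1, h2, hd, j1, j2⟩ := h
  exact ⟨C₂, C₁, h2, h1, hd.symm, j2, j1⟩

lemma symm_left (h : LinkTwo A s₁ t₁ s₂ t₂) : LinkTwo A t₁ s₁ s₂ t₂ := by
  obtain ⟨C₁, C₂, h1, h2, hd, j1, j2⟩ := h
  exact ⟨C₁, C₂, h1, h2, hd, j1.symm, j2⟩

lemma symm_right (h : LinkTwo A s₁ t₁ s₂ t₂) : LinkTwo A s₁ t₁ t₂ s₂ := h.swap.symm_left.swap

end LinkTwo

section FourCube

variable {I : Finset ι} {c z s₁ t₁ s₂ t₂ : ι → Bool} {i : ι}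

/-- On side `b`, the vertices of `Y` other than `z` are reserved for the second pair, which
otherwise stays in the opposite facet. -/
lemma linkTwo_of_facets (hi : i ∈ I) {b : Bool} {Y : Finset (ι → Bool)}
    (h₁ : Joined (face (I.erase i) (Function.update c i b) \ Y) s₁ t₁) (hz : z i = b → z ∈ Y)
    (h₂ : Joined ({v | v ∈ face I c ∧ v ∈ Y ∧ v ≠ z} ∪
      (face (I.erase i) (Function.update c i (!b)) \ {z})) s₂ t₂) :
    LinkTwo (face I c \ {z}) s₁ t₁ s₂ t₂ := by
  refine ⟨_, _, ?_, ?_, ?_, h₁, h₂⟩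
  · rintro v ⟨hv, hvY⟩
    refine ⟨facet_subset hi _ hv, ?_⟩
    rintro rfl
    exact hvY (hz ((mem_facet hi).1 hv).2)
  · rintro v (⟨h1, _, h2⟩ | ⟨hv, h2⟩)
    · exact ⟨h1, h2⟩
    · exact ⟨facet_subset hi _ hv, h2⟩
  · rw [Set.disjoint_left]
    rintro v ⟨hv, hvY⟩ (⟨_, h1, _⟩ | ⟨h1, _⟩)
    · exact hvY h1
    · have h2 := ((mem_facet hi).1 h1).2
      rw [((mem_facet hi).1 hv).2] at h2
      simp at h2

lemma joined_facet_diff_of_card_le (hi : i ∈ I) {b : Bool} {Y : Finset (ι → Bool)}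
    (hY : Y.card ≤ I.card - 2) {s t : ι → Bool} (hs : s ∈ face I c) (hsb : s i = b) (hsY : s ∉ Y)
    (ht : t ∈ face I c) (htb : t i = b) (htY : t ∉ Y) :
    Joined (face (I.erase i) (Function.update c i b) \ Y) s t :=
  joined_facet_diff hi ((Finset.card_filter_le _ _).trans hY) hs hsY hsb ht htY htb

lemma joined_facet_diff_singleton (hI : I.card = 4) (hi : i ∈ I) {b : Bool} {s t : ι → Bool}
    (hs : s ∈ face I c) (hsb : s i = b) (hsz : s ≠ z)
    (ht : t ∈ face I c) (htb : t i = b) (htz : t ≠ z) :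
    Joined (face (I.erase i) (Function.update c i b) \ {z}) s t := by
  have := joined_facet_diff_of_card_le (Y := {z}) hi (by simp [hI]) hs hsb (by simpa using hsz) ht
    htb (by simpa using htz)
  simpa using this

/-- The second pair crosses at `s₂`. If that crossing hits `z`, it first moves to one of the three
neighbours of `s₂` in the facet other than `s₁` and `t₁`. Either way at most two vertices of the
3-dimensional facet are denied to the first pair. -/
lemma linkTwo_three_one (hI : I.card = 4) (hi : i ∈ I) {b : Bool} (hs₁ : s₁ ∈ face I c)
    (ht₁ : t₁ ∈ face I c) (hs₂ : s₂ ∈ face I c) (ht₂ : t₂ ∈ face I c) (h₁z : s₁ ≠ z)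
    (h₁z' : t₁ ≠ z) (h₂z : s₂ ≠ z) (h₂z' : t₂ ≠ z) (h₁₂ : s₁ ≠ s₂) (h₁₂' : t₁ ≠ s₂)
    (hs₁b : s₁ i = b) (ht₁b : t₁ i = b) (hs₂b : s₂ i = b) (ht₂b : t₂ i = !b) :
    LinkTwo (face I c \ {z}) s₁ t₁ s₂ t₂ := by
  classical
  by_cases hz : toggle i s₂ = z
  · obtain ⟨l, hl, hl₁, hl₂⟩ : ∃ l ∈ I.erase i, toggle l s₂ ≠ s₁ ∧ toggle l s₂ ≠ t₁ := by
      have hc : ({s₁, t₁} : Finset (ι → Bool)).card <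
          ((I.erase i).image (fun l => toggle l s₂)).card := by
        rw [Finset.card_image_of_injective _ (fun _ _ h => toggle_dir_injective h),
          Finset.card_erase_of_mem hi, hI]
        exact Finset.card_le_two.trans_lt (by norm_num)
      obtain ⟨v, hv, hv'⟩ := Finset.exists_mem_notMem_of_card_lt_card hc
      obtain ⟨l, hl, rfl⟩ := Finset.mem_image.1 hv
      simp only [Finset.mem_insert, Finset.mem_singleton, not_or] at hv'
      exact ⟨l, hl, hv'⟩
    have hli := Finset.ne_of_mem_erase hl
    have hlf := toggle_mem_face (Finset.mem_of_mem_erase hl) hs₂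
    have hzi : z i = !b := by rw [← hz, toggle_same, hs₂b]
    have hwi : toggle l s₂ i = b := by rw [toggle_of_ne hli.symm, hs₂b]
    have hwz : toggle l s₂ ≠ z := by
      intro e
      rw [e, hzi] at hwi
      simp at hwi
    have hwz' : toggle i (toggle l s₂) ≠ z := by
      rw [← hz]
      exact fun e => toggle_ne_self l s₂ (toggle_injective i e)
    refine linkTwo_of_facets (Y := {s₂, toggle l s₂}) (b := b) hi
      (joined_facet_diff_of_card_le hi ?_ hs₁ hs₁b ?_ ht₁ ht₁b ?_) ?_ ?_
    · rw [hI]; exact Finset.card_le_two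
    · simp [h₁₂, hl₁.symm]
    · simp [h₁₂', hl₂.symm]
    · intro h; rw [hzi] at h; simp at h
    · have hJ := (joined_facet_diff_singleton (z := z) hI hi (toggle_mem_face hi hlf)
        (by rw [toggle_same, hwi] : _ = !b) hwz' ht₂ ht₂b h₂z')
      refine Joined.trans (.step l ?_ ?_) (Joined.trans (.step i ?_ ?_)
        (hJ.mono Set.subset_union_right))
      · exact .inl ⟨hs₂, by simp, h₂z⟩
      · exact .inl ⟨hlf, by simp, hwz⟩
      · exact .inl ⟨hlf, by simp, hwz⟩
      · exact .inr hJ.left_mem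
  · refine linkTwo_of_facets (Y := {s₂, z}) (b := b) hi
      (joined_facet_diff_of_card_le hi ?_ hs₁ hs₁b ?_ ht₁ ht₁b ?_) ?_ ?_
    · rw [hI]; exact Finset.card_le_two
    · simp [h₁₂, h₁z]
    · simp [h₁₂', h₁z']
    · simp
    · have hJ := (joined_facet_diff_singleton (z := z) hI hi (toggle_mem_face hi hs₂)
        (by rw [toggle_same, hs₂b] : _ = !b) hz ht₂ ht₂b h₂z')
      refine Joined.trans (.step i ?_ ?_) (hJ.mono Set.subset_union_right)
      · exact .inl ⟨hs₂, by simp, h₂z⟩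
      · exact .inr hJ.left_mem

/-- The second pair crosses at both ends and is joined in the opposite facet, which is still
connected without `z`. -/
lemma linkTwo_of_joined_facet (hI : I.card = 4) (hi : i ∈ I) {b : Bool} {Y : Finset (ι → Bool)}
    (hs₂ : s₂ ∈ face I c) (ht₂ : t₂ ∈ face I c) (h₂z : s₂ ≠ z) (h₂z' : t₂ ≠ z)
    (hs₂b : s₂ i = b) (ht₂b : t₂ i = b) (hz : toggle i s₂ ≠ z) (hz' : toggle i t₂ ≠ z)
    (hYz : z i = b → z ∈ Y) (hYs : s₂ ∈ Y) (hYt : t₂ ∈ Y)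
    (hJ : Joined (face (I.erase i) (Function.update c i b) \ Y) s₁ t₁) :
    LinkTwo (face I c \ {z}) s₁ t₁ s₂ t₂ := by
  refine linkTwo_of_facets hi hJ hYz ?_
  have hJ' := joined_facet_diff_singleton (z := z) hI hi (toggle_mem_face hi hs₂)
    (by rw [toggle_same, hs₂b] : _ = !b) hz (toggle_mem_face hi ht₂)
    (by rw [toggle_same, ht₂b] : _ = !b) hz'
  refine Joined.trans (.step i ?_ ?_) ((hJ'.mono Set.subset_union_right).trans
    (Joined.symm (.step i ?_ ?_)))
  · exact .inl ⟨hs₂, hYs, h₂z⟩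
  · exact .inr hJ'.left_mem
  · exact .inl ⟨ht₂, hYt, h₂z'⟩
  · exact .inr hJ'.right_mem

/-- If some vertex of the first pair is isolated by the second pair and `z` in a facet, then no
vertex of the second pair is isolated by the first pair and `z`. -/
lemma exists_toggle_notMem_of_isolated {J : Finset ι} (hJ : J.card = 3) {u w : ι → Bool}
    (h : ∀ l ∈ J, toggle l u ∈ ({s₂, t₂, z} : Set (ι → Bool))) (h₂ : s₂ ≠ t₂) (h₂z : s₂ ≠ z)
    (h₂z' : t₂ ≠ z) : ∀ v ∈ ({s₂, t₂} : Set (ι → Bool)),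
      ∃ l ∈ J, toggle l v ∉ ({u, w, z} : Set (ι → Bool)) := by
  classical
  -- The three neighbours of `u` in the face are exactly `s₂`, `t₂` and `z`, so a vertex at distance
  -- two from `u` avoids `z`.
  have himg : J.image (fun l => toggle l u) = {s₂, t₂, z} := by
    apply Finset.eq_of_subset_of_card_le
    · intro v hv
      obtain ⟨l, hl, rfl⟩ := Finset.mem_image.1 hv
      simpa using h l hl
    · rw [Finset.card_image_of_injective _ (fun _ _ h => toggle_dir_injective h), hJ]
      exact Finset.card_le_three
  have hn : ∀ v ∈ ({s₂, t₂, z} : Finset (ι → Bool)), ∃ j, toggle j u = v := by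
    intro v hv
    rw [← himg] at hv
    obtain ⟨l, _, h⟩ := Finset.mem_image.1 hv
    exact ⟨l, h⟩
  obtain ⟨m, hm⟩ := hn z (by simp)
  intro v hv
  obtain ⟨j, rfl⟩ := hn v (by rcases hv with rfl | rfl <;> simp)
  obtain ⟨l, hl, h1, h2, h3⟩ := exists_toggle_notMem_nhd (J := J) hJ.ge j u w
  refine ⟨l, hl, ?_⟩
  rintro (h | h | h)
  · exact h1 h
  · exact h2 h
  · exact h3 m (h.trans hm.symm)

/-- The hard case has all four terminals in one facet. If `z` lies there too, one pair crosses and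
the other stays; if isolation prevents this, exchanging the pairs works. If `z` lies opposite, it is
the mirror image of at most one terminal, and a pair without that terminal crosses. -/
lemma linkTwo_of_agree (hI : I.card = 4) (hi : i ∈ I) (hs₁ : s₁ ∈ face I c)
    (ht₁ : t₁ ∈ face I c) (hs₂ : s₂ ∈ face I c) (ht₂ : t₂ ∈ face I c) (h₁z : s₁ ≠ z)
    (h₁z' : t₁ ≠ z) (h₂z : s₂ ≠ z) (h₂z' : t₂ ≠ z) (hss : s₁ ≠ s₂) (hts : t₁ ≠ s₂)
    (hst : s₁ ≠ t₂) (htt : t₁ ≠ t₂) (h₂ : s₂ ≠ t₂) (h : s₁ i = t₁ i) :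
    LinkTwo (face I c \ {z}) s₁ t₁ s₂ t₂ := by
  classical
  have hor : ∀ v : ι → Bool, v i = s₁ i ∨ v i = !s₁ i := by
    intro v
    cases v i <;> cases s₁ i <;> simp
  rcases hor s₂ with h2 | h2 <;> rcases hor t₂ with h3 | h3
  · have hJ : (I.erase i).card = 3 := by rw [Finset.card_erase_of_mem hi, hI]
    have hs₁f : s₁ ∈ face (I.erase i) (Function.update c i (s₁ i)) := (mem_facet hi).2 ⟨hs₁, rfl⟩
    have ht₁f : t₁ ∈ face (I.erase i) (Function.update c i (s₁ i)) := (mem_facet hi).2 ⟨ht₁, h.symm⟩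
    have hs₂f : s₂ ∈ face (I.erase i) (Function.update c i (s₁ i)) := (mem_facet hi).2 ⟨hs₂, h2⟩
    have ht₂f : t₂ ∈ face (I.erase i) (Function.update c i (s₁ i)) := (mem_facet hi).2 ⟨ht₂, h3⟩
    by_cases hzs : z i = s₁ i
    · have htog : ∀ v : ι → Bool, v i = s₁ i → toggle i v ≠ z := by
        rintro v hv rfl
        rw [toggle_same, hv] at hzs
        simp at hzs
      have hjoin : (∃ l ∈ I.erase i, toggle l s₁ ∉ ({s₂, t₂, z} : Set (ι → Bool))) →
          (∃ l ∈ I.erase i, toggle l t₁ ∉ ({s₂, t₂, z} : Set (ι → Bool))) →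
          LinkTwo (face I c \ {z}) s₁ t₁ s₂ t₂ := by
        intro e1 e2
        refine linkTwo_of_joined_facet (Y := {s₂, t₂, z}) hI hi hs₂ ht₂ h₂z h₂z' h2 h3
          (htog _ h2) (htog _ h3) (by simp) (by simp) (by simp) ?_
        refine joined_face_diff_of_nonisolated hJ.ge (hJ ▸ Finset.card_le_three) hs₁f ?_ ht₁f ?_
          ?_ ?_
        · simp [hss, hst, h₁z]
        · simp [hts, htt, h₁z']
        · simpa using e1
        · simpa using e2
      have hjoin' : (∃ l ∈ I.erase i, toggle l s₂ ∉ ({s₁, t₁, z} : Set (ι → Bool))) →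
          (∃ l ∈ I.erase i, toggle l t₂ ∉ ({s₁, t₁, z} : Set (ι → Bool))) →
          LinkTwo (face I c \ {z}) s₁ t₁ s₂ t₂ := by
        intro e1 e2
        refine (linkTwo_of_joined_facet (Y := {s₁, t₁, z}) hI hi hs₁ ht₁ h₁z h₁z' rfl h.symm
          (htog _ rfl) (htog _ h.symm) (by simp) (by simp) (by simp) ?_).swap
        refine joined_face_diff_of_nonisolated hJ.ge (hJ ▸ Finset.card_le_three) hs₂f ?_ ht₂f ?_
          ?_ ?_
        · simp [hss.symm, hts.symm, h₂z]
        · simp [hst.symm, htt.symm, h₂z']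
        · simpa using e1
        · simpa using e2
      by_cases e1 : ∃ l ∈ I.erase i, toggle l s₁ ∉ ({s₂, t₂, z} : Set (ι → Bool))
      · by_cases e2 : ∃ l ∈ I.erase i, toggle l t₁ ∉ ({s₂, t₂, z} : Set (ι → Bool))
        · exact hjoin e1 e2
        · push Not at e2
          have := exists_toggle_notMem_of_isolated (w := s₁) hJ e2 h₂ h₂z h₂z'
          rw [Set.insert_comm] at this
          exact hjoin' (this _ (by simp)) (this _ (by simp))
      · push Not at e1
        have := exists_toggle_notMem_of_isolated (w := t₁) hJ e1 h₂ h₂z h₂z'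
        exact hjoin' (this _ (by simp)) (this _ (by simp))
    · by_cases hz : toggle i s₂ ≠ z ∧ toggle i t₂ ≠ z
      · refine linkTwo_of_joined_facet (Y := {s₂, t₂}) hI hi hs₂ ht₂ h₂z h₂z' h2 h3 hz.1 hz.2
          (fun e => absurd e hzs) (by simp) (by simp) ?_
        refine joined_facet_diff_of_card_le hi (hI ▸ Finset.card_le_two) hs₁ rfl ?_ ht₁ h.symm ?_
        · simp [hss, hst]
        · simp [hts, htt]
      · have hz' : ∃ v, (v = s₂ ∨ v = t₂) ∧ toggle i v = z := by
          by_contra! hcon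
          exact hz ⟨hcon _ (.inl rfl), hcon _ (.inr rfl)⟩
        obtain ⟨v, hv, hvz⟩ := hz'
        refine (linkTwo_of_joined_facet (Y := {s₁, t₁}) hI hi hs₁ ht₁ h₁z h₁z' rfl h.symm
          ?_ ?_ (fun e => absurd e hzs) (by simp) (by simp) ?_).swap
        · intro e
          have := toggle_injective i (e.trans hvz.symm)
          rcases hv with rfl | rfl
          · exact hss this
          · exact hst this
        · intro e
          have := toggle_injective i (e.trans hvz.symm)
          rcases hv with rfl | rfl
          · exact hts this
          · exact htt this
        · refine joined_facet_diff_of_card_le hi (hI ▸ Finset.card_le_two) hs₂ h2 ?_ ht₂ h3 ?_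
          · simp [hss.symm, hts.symm]
          · simp [hst.symm, htt.symm]
  · exact linkTwo_three_one hI hi hs₁ ht₁ hs₂ ht₂ h₁z h₁z' h₂z h₂z' hss hts rfl h.symm h2 h3
  · exact (linkTwo_three_one hI hi hs₁ ht₁ ht₂ hs₂ h₁z h₁z' h₂z' h₂z hst htt rfl h.symm h3
      h2).symm_right
  · refine linkTwo_of_facets (Y := {z}) hi (b := s₁ i) ?_ (by simp) ?_
    · have := joined_facet_diff_singleton (z := z) hI hi hs₁ rfl h₁z ht₁ h.symm h₁z'
      simpa using this
    · exact (joined_facet_diff_singleton hI hi hs₂ h2 h₂z ht₂ h3 h₂z').mono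
        Set.subset_union_right

/-- The first pair travels on side `b` avoiding `s₂` and crosses at `t₁`; the second crosses at `s₂`
and travels on the other side avoiding `t₁` and `z`. -/
lemma linkTwo_of_opposite (hI : I.card = 4) (hi : i ∈ I) {b : Bool} (hs₁ : s₁ ∈ face I c)
    (ht₁ : t₁ ∈ face I c) (hs₂ : s₂ ∈ face I c) (ht₂ : t₂ ∈ face I c)
    (h₁z' : t₁ ≠ z) (h₂z : s₂ ≠ z) (h₂z' : t₂ ≠ z) (hss : s₁ ≠ s₂) (hts : t₁ ≠ s₂)
    (htt : t₁ ≠ t₂) (hs₁b : s₁ i = b) (ht₁b : t₁ i = !b) (hs₂b : s₂ i = b) (ht₂b : t₂ i = !b)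
    (hzb : z i = !b) (he : toggle i s₂ ≠ t₁) (hz : toggle i s₂ ≠ z) :
    LinkTwo (face I c \ {z}) s₁ t₁ s₂ t₂ := by
  classical
  have ht₁t : toggle i t₁ ≠ s₂ := fun e => he (eq_toggle_comm e.symm).symm
  have ht₁i : toggle i t₁ i = b := by rw [toggle_same, ht₁b, Bool.not_not]
  have hs₂i : toggle i s₂ i = !b := by rw [toggle_same, hs₂b]
  have hJ₁ := joined_facet_diff_singleton (z := s₂) hI hi hs₁ hs₁b hss (toggle_mem_face hi ht₁)
    ht₁i ht₁t
  have hJ₂ := joined_facet_diff_of_card_le (Y := {t₁, z}) hi (hI ▸ Finset.card_le_two)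
    (toggle_mem_face hi hs₂) hs₂i (by simp [he, hz]) ht₂ ht₂b (by simp [htt.symm, h₂z'])
  refine ⟨_ ∪ {t₁}, _ ∪ {s₂}, ?_, ?_, ?_, (hJ₁.mono Set.subset_union_left).trans ?_,
    Joined.trans ?_ (hJ₂.mono Set.subset_union_left)⟩
  · rintro v (hv | rfl)
    · obtain ⟨h1, h2⟩ := (mem_facet hi).1 hv.1
      refine ⟨h1, ?_⟩
      rintro rfl
      rw [hzb] at h2
      simp at h2
    · exact ⟨ht₁, h₁z'⟩
  · rintro v (hv | rfl)
    · refine ⟨facet_subset hi _ hv.1, ?_⟩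
      rintro rfl
      exact hv.2 (by simp)
    · exact ⟨hs₂, h₂z⟩
  · rw [Set.disjoint_left]
    rintro v (hv | rfl) (hv' | e)
    · have h1 := ((mem_facet hi).1 hv.1).2
      rw [((mem_facet hi).1 hv'.1).2] at h1
      simp at h1
    · exact hv.2 e
    · exact hv'.2 (by simp)
    · exact hts e
  · exact Joined.symm (.step i (.inr rfl) (.inl hJ₁.right_mem))
  · exact .step i (.inr rfl) (.inl hJ₂.left_mem)

/-- What remains after `linkTwo_of_agree` is two antipodal pairs. A direction without edges between
the four terminals splits both pairs. Name the ends so that `s₁` and `s₂` lie opposite to `z`; at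
most one of them is mirrored to `z`, so the pairs can be ordered to suit `linkTwo_of_opposite`. -/
lemma linkTwo_four (hI : I.card = 4) (hs₁ : s₁ ∈ face I c)
    (ht₁ : t₁ ∈ face I c) (hs₂ : s₂ ∈ face I c) (ht₂ : t₂ ∈ face I c) (h₁z : s₁ ≠ z)
    (h₁z' : t₁ ≠ z) (h₂z : s₂ ≠ z) (h₂z' : t₂ ≠ z) (hss : s₁ ≠ s₂) (hts : t₁ ≠ s₂)
    (hst : s₁ ≠ t₂) (htt : t₁ ≠ t₂) (h₁ : s₁ ≠ t₁) (h₂ : s₂ ≠ t₂) :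
    LinkTwo (face I c \ {z}) s₁ t₁ s₂ t₂ := by
  classical
  by_cases e1 : ∃ i ∈ I, s₁ i = t₁ i
  · obtain ⟨i, hi, h⟩ := e1
    exact linkTwo_of_agree hI hi hs₁ ht₁ hs₂ ht₂ h₁z h₁z' h₂z h₂z' hss hts hst htt h₂ h
  by_cases e2 : ∃ i ∈ I, s₂ i = t₂ i
  · obtain ⟨i, hi, h⟩ := e2
    exact (linkTwo_of_agree hI hi hs₂ ht₂ hs₁ ht₁ h₂z h₂z' h₁z h₁z' hss.symm hst.symm hts.symm
      htt.symm h₁ h).swap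
  push Not at e1 e2
  obtain ⟨i, hi, hE⟩ := exists_direction_of_card_lt (X := {s₁, t₁, s₂, t₂}) (I := I) (by
    have := Finset.card_le_four (a := s₁) (b := t₁) (c := s₂) (d := t₂)
    omega)
  have hE' : ∀ u ∈ ({s₁, t₁, s₂, t₂} : Finset (ι → Bool)),
    ∀ v ∈ ({s₁, t₁, s₂, t₂} : Finset (ι → Bool)), toggle i u ≠ v := by
    rintro u hu v hv rfl
    exact hE u hu hv
  have main : ∀ {s₁ t₁ s₂ t₂ : ι → Bool}, s₁ ∈ face I c → t₁ ∈ face I c → s₂ ∈ face I c →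
      t₂ ∈ face I c → s₁ ≠ z → t₁ ≠ z → s₂ ≠ z → t₂ ≠ z → s₁ ≠ s₂ → t₁ ≠ s₂ → s₁ ≠ t₂ → t₁ ≠ t₂ →
      toggle i s₂ ≠ t₁ → toggle i s₁ ≠ t₂ → s₁ i = (!z i) → t₁ i = z i → s₂ i = (!z i) →
      t₂ i = z i → LinkTwo (face I c \ {z}) s₁ t₁ s₂ t₂ := by
    intro s₁ t₁ s₂ t₂ hs₁ ht₁ hs₂ ht₂ h₁z h₁z' h₂z h₂z' hss hts hst htt he he' a1 a2 a3 a4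
    by_cases hz : toggle i s₂ = z
    · refine (linkTwo_of_opposite hI hi hs₂ ht₂ hs₁ ht₁ h₂z' h₁z h₁z' hss.symm hst.symm htt.symm a3
        ?_ a1 ?_ ?_ he' ?_).swap
      · simpa using a4
      · simpa using a2
      · simp
      · rw [← hz]
        exact fun e => hss (toggle_injective i e)
    · refine linkTwo_of_opposite hI hi hs₁ ht₁ hs₂ ht₂ h₁z' h₂z h₂z' hss hts htt a1 ?_ a3 ?_ ?_ he hz
      · simpa using a2
      · simpa using a4
      · simp
  have hside : ∀ u v : ι → Bool, u i ≠ v i → (u i = (!z i) ∧ v i = z i) ∨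
      (v i = (!z i) ∧ u i = z i) := by
    intro u v
    cases u i <;> cases v i <;> cases z i <;> simp
  rcases hside _ _ (e1 i hi) with ⟨a1, a2⟩ | ⟨a1, a2⟩ <;>
    rcases hside _ _ (e2 i hi) with ⟨a3, a4⟩ | ⟨a3, a4⟩
  · exact main hs₁ ht₁ hs₂ ht₂ h₁z h₁z' h₂z h₂z' hss hts hst htt (hE' _ (by simp) _ (by simp))
      (hE' _ (by simp) _ (by simp)) a1 a2 a3 a4
  · exact (main hs₁ ht₁ ht₂ hs₂ h₁z h₁z' h₂z' h₂z hst htt hss hts (hE' _ (by simp) _ (by simp))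
      (hE' _ (by simp) _ (by simp)) a1 a2 a3 a4).symm_right
  · exact (main ht₁ hs₁ hs₂ ht₂ h₁z' h₁z h₂z h₂z' hts hss htt hst (hE' _ (by simp) _ (by simp))
      (hE' _ (by simp) _ (by simp)) a1 a2 a3 a4).symm_left
  · exact (main ht₁ hs₁ ht₂ hs₂ h₁z' h₁z h₂z' h₂z htt hst hts hss (hE' _ (by simp) _ (by simp))
      (hE' _ (by simp) _ (by simp)) a1 a2 a3 a4).symm_left.symm_right

end FourCube

/-! ### Induction on the dimension -/

lemma strongLinked_four {I : Finset ι} (hI : I.card = 4) : StrongLinked κ I 2 := by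
  classical
  intro c K x Z hK hx hmem hZ hxZ
  obtain ⟨X, hX, hXc⟩ := exists_finset_terms K x hx
  obtain ⟨a, b, hab, rfl⟩ := Finset.card_eq_two.1 hK
  have ha : a ∈ ({a, b} : Finset κ) := by simp
  have hb : b ∈ ({a, b} : Finset κ) := by simp
  obtain ⟨z, hz, hxz⟩ : ∃ z, Z ⊆ {z} ∧ ∀ a' ∈ ({a, b} : Finset κ), ∀ p, x a' p ≠ z := by
    rcases hZ.eq_empty_or_singleton with rfl | ⟨z, rfl⟩
    -- With nothing forbidden, any non-terminal may serve as `z`: one of the four neighbours of a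
    -- terminal is not among the three other terminals.
    · have hc : (X.erase (x a false)).card < (I.image (fun l => toggle l (x a false))).card := by
        rw [Finset.card_image_of_injective _ (fun _ _ h => toggle_dir_injective h),
          Finset.card_erase_of_mem ((hX _).2 ⟨a, ha, false, rfl⟩)]
        omega
      obtain ⟨v, hv, hv'⟩ := Finset.exists_mem_notMem_of_card_lt_card hc
      obtain ⟨l, hl, rfl⟩ := Finset.mem_image.1 hv
      refine ⟨toggle l (x a false), Set.empty_subset _, fun a' ha' p e => hv' ?_⟩
      exact Finset.mem_erase.2 ⟨toggle_ne_self _ _, (hX _).2 ⟨a', ha', p, e⟩⟩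
    · exact ⟨z, subset_rfl, fun a' ha' p e => hxZ a' ha' p e⟩
  have hne : ∀ p q, x a p ≠ x b q := fun p q e => hab (hx a ha b hb p q e).1
  obtain ⟨C₁, C₂, h1, h2, hd, j1, j2⟩ := linkTwo_four hI (hmem a ha false) (hmem a ha true)
    (hmem b hb false) (hmem b hb true) (hxz a ha _) (hxz a ha _) (hxz b hb _) (hxz b hb _)
    (hne _ _) (hne _ _) (hne _ _) (hne _ _)
    (fun e => by simpa using (hx a ha a ha _ _ e).2) (fun e => by simpa using (hx b hb b hb _ _ e).2)
  have hsub : face I c \ {z} ⊆ face I c \ Z := Set.sdiff_subset_sdiff_right hz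
  refine ⟨fun a' => if a' = a then C₁ else C₂, ?_, ?_⟩
  · intro a' ha'
    rcases Finset.mem_insert.1 ha' with rfl | h
    · simpa using ⟨h1.trans hsub, j1⟩
    · rw [Finset.mem_singleton.1 h]
      simpa [hab.symm] using ⟨h2.trans hsub, j2⟩
  · simp only [Finset.mem_insert, Finset.mem_singleton]
    rintro a' (rfl | rfl) b' (rfl | rfl) hne'
    · exact absurd rfl hne'
    · simpa [hab.symm] using hd
    · simpa [hab.symm] using hd.symm
    · exact absurd rfl hne'

/-- Each step descends two dimensions, through facets and then facets of facets. -/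
lemma strongLinked_even [DecidableEq κ] {k : ℕ} (hk : 2 ≤ k) {I : Finset ι} (hI : I.card = 2 * k) :
    StrongLinked κ I k := by
  induction k, hk using Nat.le_induction generalizing I with
  | base => exact strongLinked_four hI
  | succ k hk ih =>
    refine strongLinked_of_linked_facets hI (by omega) fun i hi => ?_
    have hc : (I.erase i).card = 2 * k + 1 := by rw [Finset.card_erase_of_mem hi]; omega
    refine linked_of_strongLinked_facets hk hc fun j hj => ih ?_
    rw [Finset.card_erase_of_mem hj]
    omega

/-- Faces of the cube of dimension `d ≠ 3` are `⌊(d + 1) / 2⌋`-linked. -/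
theorem linked_face [DecidableEq κ] {I : Finset ι} (hI : I.card ≠ 3) :
    Linked κ I ((I.card + 1) / 2) := by
  intro c K x hK hx hmem
  obtain ⟨k, hk | hk⟩ : ∃ k, I.card = 2 * k ∨ I.card = 2 * k + 1 := ⟨I.card / 2, by omega⟩
  · by_cases hk2 : 2 ≤ k
    · have := strongLinked_even (κ := κ) hk2 hk c K x ∅ (by omega) hx hmem
        Set.subsingleton_empty (by simp)
      simpa using this
    · have hK1 : K.card ≤ 1 := by omega
      refine ⟨fun _ => face I c, fun a ha => ⟨subset_rfl, ?_⟩,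
        fun a ha b hb hne => absurd (Finset.card_le_one.1 hK1 a ha b hb) hne⟩
      have := joined_face_diff (Y := ∅) (by simp) (hmem a ha false) (by simp) (hmem a ha true)
        (by simp)
      simpa using this
  · by_cases hk2 : 2 ≤ k
    · refine linked_of_strongLinked_facets hk2 hk (fun i hi => strongLinked_even hk2 ?_) c K x
        (by omega) hx hmem
      rw [Finset.card_erase_of_mem hi]
      omega
    -- Here `hI` excludes `k = 1`, so the face is an edge.
    · have hK1 : K.card ≤ 1 := by omega
      refine ⟨fun _ => face I c, fun a ha => ⟨subset_rfl, ?_⟩,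
        fun a ha b hb hne => absurd (Finset.card_le_one.1 hK1 a ha b hb) hne⟩
      have := joined_face_diff (Y := ∅) (by simp) (hmem a ha false) (by simp) (hmem a ha true)
        (by simp)
      simpa using this

end CubeGraph

/-! ### The face lattice of a polytope determines its graph -/

namespace Polytope

section FaceLattice

variable {n : ℕ}

/-- Extreme points of a polytope are exposed. -/
lemma isExposed_singleton_of_mem_extremePoints {S : Set (Fin n → ℝ)} (hS : S.Finite)
    {v : Fin n → ℝ} (hv : v ∈ (convexHull ℝ S).extremePoints ℝ) :
    IsExposed ℝ (convexHull ℝ S) {v} := by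
  have hvS : v ∈ S := extremePoints_convexHull_subset hv
  have hsub : convexHull ℝ (S \ {v}) ⊆ convexHull ℝ S := convexHull_mono Set.sdiff_subset
  have hvn : v ∉ convexHull ℝ (S \ {v}) := fun h =>
    (extremePoints_convexHull_subset
      (inter_extremePoints_subset_extremePoints_of_subset hsub ⟨h, hv⟩)).2 rfl
  obtain ⟨f, r, hr, hrv⟩ := geometric_hahn_banach_closed_point (convex_convexHull ℝ _)
    ((hS.subset Set.sdiff_subset).isClosed_convexHull ℝ) hvn
  have key : ∀ y ∈ convexHull ℝ S, f y ≤ f v ∧ (f v ≤ f y → y = v) := by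
    intro y hy
    rcases (S \ {v}).eq_empty_or_nonempty with he | hne
    · have : S ⊆ {v} := Set.sdiff_eq_empty.1 he
      have hyv : y = v := by simpa using convexHull_mono this hy
      subst hyv
      exact ⟨le_rfl, fun _ => rfl⟩
    -- Every point of the polytope lies on a segment from `v` to a point of the hull of the other
    -- generators, where `f` is strictly smaller.
    · rw [← Set.insert_sdiff_self_of_mem hvS, convexHull_insert hne, mem_convexJoin] at hy
      obtain ⟨a, rfl, b, hb, α, β, hα, hβ, hαβ, rfl⟩ := hy
      have hfb : f b < f a := (hr b hb).trans hrv
      have hf : f (α • a + β • b) = f a - β * (f a - f b) := by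
        rw [map_add, map_smul, map_smul, smul_eq_mul, smul_eq_mul]
        have : α = 1 - β := by linarith
        rw [this]; ring
      rw [hf]
      have hpos : 0 < f a - f b := by linarith
      refine ⟨by nlinarith, fun h => ?_⟩
      have hβ0 : β = 0 := by
        by_contra hne
        have : 0 < β := lt_of_le_of_ne hβ (Ne.symm hne)
        have := mul_pos this hpos
        linarith
      have hα1 : α = 1 := by linarith
      simp [hβ0, hα1]
  refine fun _ => ⟨f, ?_⟩
  ext y
  constructor
  · rintro rfl
    exact ⟨hv.1, fun y hy => (key y hy).1⟩
  · rintro ⟨hy, h⟩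
    exact (key y hy).2 (h v hv.1)

/-- A face of a polytope is the convex hull of its vertices. -/
lemma face_eq_convexHull {P F : Set (Fin n → ℝ)} (hP : IsPolytope P) (hF : IsExposed ℝ P F) :
    F = convexHull ℝ {v | IsExposed ℝ P {v} ∧ v ∈ F} := by
  obtain ⟨S, hS, rfl⟩ := hP
  have hFconv : Convex ℝ F := hF.convex (convex_convexHull ℝ S)
  apply Set.Subset.antisymm
  · have hFc : IsCompact F := hF.isCompact (hS.isCompact_convexHull ℝ)
    have hext : F.extremePoints ℝ ⊆ (convexHull ℝ S).extremePoints ℝ :=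
      hF.isExtreme.extremePoints_subset_extremePoints
    have hfin : (F.extremePoints ℝ).Finite :=
      hS.subset (hext.trans extremePoints_convexHull_subset)
    -- Krein–Milman; the closure is redundant because the extreme points are finite in number.
    have hKM := closure_convexHull_extremePoints hFc hFconv
    rw [(hfin.isClosed_convexHull ℝ).closure_eq] at hKM
    conv_lhs => rw [← hKM]
    exact convexHull_mono fun v hv => ⟨isExposed_singleton_of_mem_extremePoints hS (hext hv), hv.1⟩
  · exact convexHull_min (fun v hv => hv.2) hFconv

instance faceLatticeOrderBot (P : Set (Fin n → ℝ)) : OrderBot (FaceLattice P) where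
  bot := ⟨∅, isExposed_empty⟩
  bot_le F := Set.empty_subset F.1

/-- The face consisting of a single vertex. -/
def vertexFace {P : Set (Fin n → ℝ)} (v : Vertex P) : FaceLattice P := ⟨{v.1}, v.2⟩

variable {P : Set (Fin n → ℝ)}

lemma vertexFace_le {v : Vertex P} {F : FaceLattice P} : vertexFace v ≤ F ↔ v.1 ∈ F.1 :=
  Set.singleton_subset_iff

lemma vertexFace_injective : Function.Injective (vertexFace (P := P)) := fun _ _ h =>
  Subtype.ext (Set.singleton_injective (congrArg Subtype.val h))

lemma isAtom_vertexFace (v : Vertex P) : IsAtom (vertexFace v) := by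
  refine ⟨fun h => ?_, fun F hF => ?_⟩
  · exact Set.singleton_ne_empty v.1 (congrArg Subtype.val h)
  · have h1 : F.1 ⊆ {v.1} := hF.le
    rcases Set.subset_singleton_iff_eq.1 h1 with h | h
    · exact Subtype.ext h
    · exact absurd (Subtype.ext h) hF.ne

/-- A nonempty face is the hull of its vertices, so it contains one, and an atom contains nothing
more. -/
lemma exists_vertexFace_eq (hP : IsPolytope P) {F : FaceLattice P} (hF : IsAtom F) :
    ∃ v : Vertex P, vertexFace v = F := by
  have hne : {v | IsExposed ℝ P {v} ∧ v ∈ F.1}.Nonempty := by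
    rw [Set.nonempty_iff_ne_empty]
    intro h
    have := face_eq_convexHull hP F.2
    rw [h, convexHull_empty] at this
    exact hF.1 (Subtype.ext this)
  obtain ⟨v, hv, hvF⟩ := hne
  refine ⟨⟨v, hv⟩, ?_⟩
  rcases hF.le_iff.1 (vertexFace_le.2 hvF : vertexFace ⟨v, hv⟩ ≤ F) with h | h
  · exact absurd h (isAtom_vertexFace _).1
  · exact h

/-- Adjacency of vertices in terms of the face lattice. -/
lemma graph_adj_iff (hP : IsPolytope P) {u v : Vertex P} :
    (graph P).Adj u v ↔
      u ≠ v ∧ ∃ F : FaceLattice P, ∀ w : Vertex P, vertexFace w ≤ F ↔ w = u ∨ w = v := by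
  refine and_congr_right fun _ => ⟨fun h => ⟨⟨_, h⟩, fun w => ?_⟩, ?_⟩
  · rw [vertexFace_le]
    constructor
    · intro hw
      have hwe : w.1 ∈ P.extremePoints ℝ :=
        exposedPoints_subset_extremePoints (mem_exposedPoints_iff_exposed_singleton.2 w.2)
      rcases (mem_extremePoints_iff_forall_segment.1 hwe).2 u.1 (u.2.subset rfl) v.1
        (v.2.subset rfl) hw with h | h
      · exact .inl (Subtype.ext h.symm)
      · exact .inr (Subtype.ext h.symm)
    · rintro (rfl | rfl)
      · exact left_mem_segment ℝ _ _
      · exact right_mem_segment ℝ _ _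
  · rintro ⟨F, hF⟩
    have : {w | IsExposed ℝ P {w} ∧ w ∈ F.1} = {u.1, v.1} := by
      ext w
      constructor
      · rintro ⟨hw, hwF⟩
        rcases (hF ⟨w, hw⟩).1 (vertexFace_le.2 hwF) with h | h
        · exact .inl (congrArg Subtype.val h)
        · exact .inr (congrArg Subtype.val h)
      · rintro (rfl | rfl)
        · exact ⟨u.2, vertexFace_le.1 ((hF u).2 (.inl rfl))⟩
        · exact ⟨v.2, vertexFace_le.1 ((hF v).2 (.inr rfl))⟩
    rw [← convexHull_pair, ← this, ← face_eq_convexHull hP F.2]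
    exact F.2

/-- Combinatorially equivalent polytopes have isomorphic graphs. -/
lemma CombinatoriallyEquivalent.nonempty_graph_iso {m : ℕ} {Q : Set (Fin m → ℝ)}
    (hP : IsPolytope P) (hQ : IsPolytope Q) (h : CombinatoriallyEquivalent P Q) :
    Nonempty (graph P ≃g graph Q) := by
  obtain ⟨φ⟩ := h
  have hex : ∀ v : Vertex P, ∃ w : Vertex Q, vertexFace w = φ (vertexFace v) := fun v =>
    exists_vertexFace_eq hQ ((φ.isAtom_iff _).2 (isAtom_vertexFace v))
  choose f hf using hex
  have hinj : Function.Injective f := fun u v h =>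
    vertexFace_injective (φ.injective (by rw [← hf, ← hf, h]))
  have hsurj : Function.Surjective f := by
    intro w
    obtain ⟨v, hv⟩ := exists_vertexFace_eq hP ((φ.symm.isAtom_iff _).2 (isAtom_vertexFace w))
    refine ⟨v, vertexFace_injective ?_⟩
    rw [hf, hv, φ.apply_symm_apply]
  refine ⟨⟨Equiv.ofBijective f ⟨hinj, hsurj⟩, ?_⟩⟩
  intro u v
  rw [graph_adj_iff hP, graph_adj_iff hQ]
  refine and_congr hinj.ne_iff ⟨?_, ?_⟩
  · rintro ⟨F, hF⟩
    refine ⟨φ.symm F, fun w => ?_⟩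
    rw [φ.le_symm_apply, ← hf, hF]
    exact or_congr hinj.eq_iff hinj.eq_iff
  · rintro ⟨F, hF⟩
    refine ⟨φ F, fun w => ?_⟩
    obtain ⟨w, rfl⟩ := hsurj w
    rw [hf, φ.le_iff_le, hF]
    exact or_congr hinj.eq_iff.symm hinj.eq_iff.symm

end FaceLattice

/-! ### Vertices and edges of the standard cube -/

section StandardCube

open CubeGraph

variable {d : ℕ}

/-- The point of `{0, 1}ᵈ` given by a vector of truth values. -/
def cubePoint (u : Fin d → Bool) : Fin d → ℝ := fun j => if u j then 1 else 0

lemma cubePoint_mem (u : Fin d → Bool) : cubePoint u ∈ Set.Icc (0 : Fin d → ℝ) 1 := by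
  constructor <;> intro j <;> by_cases h : u j <;> simp [cubePoint, h]

lemma cubePoint_injective : Function.Injective (cubePoint (d := d)) := by
  intro u v h
  funext j
  have := congrFun h j
  revert this
  cases hu : u j <;> cases hv : v j <;> simp [cubePoint, hu, hv]

lemma isPolytope_cube (d : ℕ) : IsPolytope (Set.Icc (0 : Fin d → ℝ) 1) := by
  refine ⟨Set.univ.pi fun _ => {0, 1}, Set.Finite.pi fun _ => Set.toFinite _, ?_⟩
  rw [convexHull_pi]
  simp [convexHull_pair, segment_eq_Icc, ← Set.pi_univ_Icc]

/-- The functional has coefficient `1` or `-1` at `j ∈ D` according to `u j`. Each term is maximal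
exactly when `x j` equals the prescribed value, and the sum is maximal exactly when every term is.
Fixing all coordinates gives vertices; all but one, edges. -/
lemma isExposed_cube_fix (u : Fin d → Bool) (D : Finset (Fin d)) :
    IsExposed ℝ (Set.Icc (0 : Fin d → ℝ) 1)
      {x | x ∈ Set.Icc (0 : Fin d → ℝ) 1 ∧ ∀ j ∈ D, x j = cubePoint u j} := by
  intro _
  let l : StrongDual ℝ (Fin d → ℝ) :=
    ∑ j ∈ D, (2 * cubePoint u j - 1) • ContinuousLinearMap.proj (R := ℝ) j
  have hl : ∀ x, l x = ∑ j ∈ D, (2 * cubePoint u j - 1) * x j := by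
    intro x
    simp [l]
  have hle : ∀ x ∈ Set.Icc (0 : Fin d → ℝ) 1, ∀ j,
      (2 * cubePoint u j - 1) * x j ≤ (2 * cubePoint u j - 1) * cubePoint u j := by
    intro x hx j
    have h0 : 0 ≤ x j := hx.1 j
    have h1 : x j ≤ 1 := hx.2 j
    by_cases h : u j
    · simp only [cubePoint, h, if_true]; linarith
    · simp only [cubePoint, h]; norm_num; exact h0
  refine ⟨l, ?_⟩
  ext x
  constructor
  · rintro ⟨hx, h⟩
    refine ⟨hx, fun y hy => ?_⟩
    rw [hl, hl]
    refine Finset.sum_le_sum fun j hj => ?_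
    rw [h j hj]
    exact hle y hy j
  · rintro ⟨hx, h⟩
    refine ⟨hx, fun j hj => ?_⟩
    have h1 := h _ (cubePoint_mem u)
    rw [hl, hl] at h1
    have h2 := (Finset.sum_eq_sum_iff_of_le fun j _ => hle x hx j).1
      (le_antisymm (Finset.sum_le_sum fun j _ => hle x hx j) h1) j hj
    revert h2
    by_cases h : u j
    · simp only [cubePoint, h, if_true]; intro h2; linarith
    · simp only [cubePoint, h]; norm_num

lemma isExposed_cubePoint (u : Fin d → Bool) :
    IsExposed ℝ (Set.Icc (0 : Fin d → ℝ) 1) {cubePoint u} := by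
  convert isExposed_cube_fix u Finset.univ using 1
  ext x
  constructor
  · rintro rfl
    exact ⟨cubePoint_mem u, fun _ _ => rfl⟩
  · rintro ⟨_, h⟩
    exact funext fun j => h j (Finset.mem_univ j)

lemma isExposed_segment_toggle (u : Fin d → Bool) (i : Fin d) :
    IsExposed ℝ (Set.Icc (0 : Fin d → ℝ) 1)
      (segment ℝ (cubePoint u) (cubePoint (toggle i u))) := by
  convert isExposed_cube_fix u (Finset.univ.erase i) using 1
  have hj : ∀ j, j ≠ i → cubePoint (toggle i u) j = cubePoint u j := fun j hj => by
    simp [cubePoint, toggle_of_ne hj]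
  have hi : cubePoint (toggle i u) i = 1 - cubePoint u i := by
    by_cases h : u i <;> simp [cubePoint, h]
  ext x
  constructor
  · intro hx
    refine ⟨(convex_Icc _ _).segment_subset (cubePoint_mem u) (cubePoint_mem _) hx, ?_⟩
    intro j hjD
    obtain ⟨a, b, _, _, hab, rfl⟩ := hx
    simp only [Pi.add_apply, Pi.smul_apply, smul_eq_mul, hj j (Finset.ne_of_mem_erase hjD)]
    rw [← add_mul, hab, one_mul]
  · rintro ⟨hx, h⟩
    have h0 : 0 ≤ x i := hx.1 i
    have h1 : x i ≤ 1 := hx.2 i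
    rw [segment_eq_image]
    refine ⟨if u i then 1 - x i else x i, ?_, ?_⟩
    · split_ifs
      · exact ⟨by linarith, by linarith⟩
      · exact ⟨h0, h1⟩
    · funext j
      simp only [Pi.add_apply, Pi.smul_apply, smul_eq_mul]
      by_cases hji : j = i
      · subst hji
        rw [hi]
        by_cases hu : u j <;> simp [cubePoint, hu]
      · rw [hj j hji, h j (by simp [hji])]
        ring

/-- The vertex of the standard cube given by a vector of truth values. -/
def cubeVertex (u : Fin d → Bool) : Vertex (Set.Icc (0 : Fin d → ℝ) 1) :=
  ⟨cubePoint u, isExposed_cubePoint u⟩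

/-- Extreme points of a product are products of extreme points, and those of the unit interval are
`0` and `1`. -/
lemma cubeVertex_bijective : Function.Bijective (cubeVertex (d := d)) := by
  refine ⟨fun u v h => cubePoint_injective (congrArg Subtype.val h), fun v => ?_⟩
  have hv : v.1 ∈ (Set.Icc (0 : Fin d → ℝ) 1).extremePoints ℝ :=
    exposedPoints_subset_extremePoints (mem_exposedPoints_iff_exposed_singleton.2 v.2)
  refine ⟨fun j => decide (v.1 j = 1), Subtype.ext (funext fun j => ?_)⟩
  have hext : (Set.Icc (0 : Fin d → ℝ) 1).extremePoints ℝ = Set.univ.pi fun i =>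
      (Set.Icc ((0 : Fin d → ℝ) i) ((1 : Fin d → ℝ) i)).extremePoints ℝ := by
    rw [← Set.pi_univ_Icc, extremePoints_pi]
  have := hext.subset hv j (Set.mem_univ j)
  simp only [Pi.zero_apply, Pi.one_apply, Set.extremePoints_Icc zero_le_one] at this
  rcases this with h | h
  · simp [cubeVertex, cubePoint, h]
  · have h : v.1 j = 1 := h
    simp [cubeVertex, cubePoint, h]

lemma graph_cube_adj_toggle (u : Fin d → Bool) (i : Fin d) :
    (graph (Set.Icc (0 : Fin d → ℝ) 1)).Adj (cubeVertex u) (cubeVertex (toggle i u)) :=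
  ⟨fun h => toggle_ne_self i u (cubeVertex_bijective.1 h).symm, isExposed_segment_toggle u i⟩

end StandardCube

end Polytope

/-! ### From linkages of Boolean vectors to paths in a graph -/

namespace CubeGraph

/-- A walk in the cube graph is carried to any graph containing an image of the cube graph. -/
lemma Joined.exists_walk {ι V : Type*} [DecidableEq ι] {G : SimpleGraph V} {f : (ι → Bool) → V}
    (hf : ∀ u i, G.Adj (f u) (f (toggle i u))) {A : Set (ι → Bool)} {u v : ι → Bool}
    (h : Joined A u v) : ∃ w : G.Walk (f u) (f v), ∀ y ∈ w.support, y ∈ Set.image f A := by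
  obtain ⟨hu, h⟩ := h
  induction h with
  | refl => exact ⟨.nil, by simpa using ⟨u, hu, rfl⟩⟩
  | @tail b c hb hc ih =>
    obtain ⟨w, hw⟩ := ih
    obtain ⟨hcA, i, rfl⟩ := hc
    refine ⟨w.concat (hf b i), fun y hy => ?_⟩
    rw [SimpleGraph.Walk.support_concat] at hy
    rcases List.mem_append.1 (by simpa using hy : y ∈ w.support ++ [f (toggle i b)]) with h | h
    · exact hw y h
    · rw [List.mem_singleton.1 h]
      exact ⟨_, hcA, rfl⟩

/-- Only one direction of adjacency is required, since further edges cannot destroy a linkage. -/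
lemma isKLinked_of_bijective {d : ℕ} (hd : d ≠ 3) {V : Type*} {G : SimpleGraph V}
    {f : (Fin d → Bool) → V} (hf : Function.Bijective f)
    (hadj : ∀ u i, G.Adj (f u) (f (toggle i u))) : G.IsKLinked ((d + 1) / 2) := by
  classical
  refine ⟨?_, fun s t hst => ?_⟩
  · rw [← ENat.card_congr (Equiv.ofBijective f hf), ENat.card_eq_coe_fintype_card]
    have h1 : d + 1 ≤ 2 ^ d := Nat.lt_two_pow_self
    have h2 : Fintype.card (Fin d → Bool) = 2 ^ d := by simp
    rw [h2]
    exact_mod_cast (by omega : 2 * ((d + 1) / 2) ≤ 2 ^ d)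
  · let e := Equiv.ofBijective f hf
    have hfe : ∀ v, f (e.symm v) = v := fun v => e.apply_symm_apply v
    let x : Fin ((d + 1) / 2) → Bool → Fin d → Bool :=
      fun a p => e.symm (if p then t a else s a)
    have hx : Distinct Finset.univ x := by
      intro a _ b _ p q h
      have h' := e.symm.injective h
      cases p <;> cases q <;> simp only [if_true, Bool.false_eq_true, if_false] at h'
      · exact ⟨Sum.inl_injective (hst (a₁ := .inl a) (a₂ := .inl b) h'), rfl⟩
      · exact absurd (hst (a₁ := .inl a) (a₂ := .inr b) h') (by simp)
      · exact absurd (hst (a₁ := .inr a) (a₂ := .inl b) h') (by simp)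
      · exact ⟨Sum.inr_injective (hst (a₁ := .inr a) (a₂ := .inr b) h'), rfl⟩
    obtain ⟨C, hC, hdis⟩ := linked_face (κ := Fin ((d + 1) / 2)) (I := (Finset.univ : Finset (Fin d)))
      (by simpa using hd) (fun _ => false) Finset.univ x (by simp) hx (fun a _ p j hj => by simp at hj)
    have hw : ∀ a, ∃ w : G.Walk (s a) (t a), ∀ y ∈ w.support, y ∈ Set.image f (C a) := by
      intro a
      obtain ⟨w, hw⟩ := (hC a (Finset.mem_univ a)).2.exists_walk hadj
      have h0 : f (x a false) = s a := hfe _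
      have h1 : f (x a true) = t a := hfe _
      exact ⟨w.copy h0 h1, by simpa using hw⟩
    choose w hw using hw
    -- Shortening a walk to a path only shrinks its support, so disjointness persists.
    refine ⟨fun a => (w a).toPath, fun a b hab => ?_⟩
    intro y hya hyb
    obtain ⟨u, hu, rfl⟩ := hw a y ((w a).support_bypass_subset_support hya)
    obtain ⟨v, hv, huv⟩ := hw b _ ((w b).support_bypass_subset_support hyb)
    rw [hf.1 huv] at hv
    exact Set.disjoint_left.1 (hdis a (Finset.mem_univ a) b (Finset.mem_univ b) hab) hu hv

end CubeGraph

theorem mainTheorem2 (d : ℕ) (hd : d ≠ 3) (n : ℕ) (P : Set (Fin n → ℝ))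
    (hP : Polytope.IsCube d P) :
    (Polytope.graph P).IsKLinked ((d + 1) / 2) := by
  obtain ⟨φ⟩ := hP.2.nonempty_graph_iso hP.1 (Polytope.isPolytope_cube d)
  exact CubeGraph.isKLinked_of_bijective hd (f := fun u => φ.symm (Polytope.cubeVertex u))
    (φ.symm.bijective.comp Polytope.cubeVertex_bijective)
    fun u i => φ.symm.map_adj_iff.2 (Polytope.graph_cube_adj_toggle u i)
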